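/- All graphs are finite, simple and undirected, with at least one vertex. An admissible sequence is a sequence of pairs $(G_n,d_n)$, where $d_n\ge 1$ is a real number and $G_n$ is a graph with all degrees $\le d_n$. For a tree $F$ put $$t(F,G_n,d_n)=\frac{\hom(F,G_n)}{|V(G_n)|\,d_n^{|V(F)|-1}},$$ where $\hom(F,G_n)$ is the number of graph homomorphisms $F\to G_n$. For a compact metric space $K$ let $\mathcal M(K)$ be the compact metrizable space of Borel measures on $K$ of total mass $\le 1$, with the topology of weak convergence; a continuous map $f:K\to L$ induces the push-forward $f_*:\mathcal M(K)\to\mathcal M(L)$. Let $M_0$ be a point and $M_{r+1}=\mathcal M(M_r)$ for $r\ge 0$. Let $f_0:M_1\to M_0$ be the unique map and $f_{r+1}=(f_r)_*:M_{r+2}\to M_{r+1}$. Let $M$ be the compact space of consistent sequences $\sigma=(\sigma_r)_{r\ge0}\in\prod_{r\ge 0} M_r$, i.e. those with $f_r(\sigma_{r+1})=\sigma_r$ for all $r$, with the topology induced from the product and with its Borel $\sigma$-algebra $\mathcal B$. The canonical sub-Markov kernel $\deg$ on $M$ is the unique one with $$\deg(\sigma)(\{\tau\in M:\tau_r\in A\})=\sigma_{r+1}(A)$$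 for all $\sigma\in M$, $r\ge 0$ and Borel sets $A\subseteq M_r$. A Borel probability measure $\lambda$ on $M$ is involution-invariant if $\int_A\deg(x)(B)\,\mathrm d\lambda(x)=\int_B\deg(x)(A)\,\mathrm d\lambda(x)$ for all $A,B\in\mathcal B$. For such $\lambda$ and a tree $F$ whose vertices are labeled $0,1,\dots,m$ so that each vertex $i\ge1$ is adjacent to some vertex $j(i)<i$, put $$t(F,(M,\mathcal B,\lambda,\deg))=\int_M\int_M\cdots\int_M 1\;\mathrm d\deg(x_{j(m)})(x_m)\cdots\mathrm d\deg(x_{j(1)})(x_1)\,\mathrm d\lambda(x_0),$$ which does not depend on the labeling. **Theorem.** Let $(G_n,d_n)$ be an admissible sequence such that $t(F,G_n,d_n)$ converges as $n\to\infty$ for every tree $F$. Then there is a unique involution-invariant Borel probability measure $\lambda$ on $M$ such that $$t(F,G_n,d_n)\to t(F,(M,\mathcal B,\lambda,\deg))\qquad (n\to\infty)$$ for every tree $F$. -/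

import Mathlib

open MeasureTheory ProbabilityTheory Filter Topology
open scoped ENNReal NNReal


namespace GraphLimit

/-- Borel measures of total mass at most `1` on `K`. -/
def SubProb (K : Type) [MeasurableSpace K] : Type :=
  {μ : FiniteMeasure K // μ.mass ≤ 1}

namespace SubProb

section
variable {K L : Type} [TopologicalSpace K] [MeasurableSpace K] [BorelSpace K]
  [TopologicalSpace L] [MeasurableSpace L] [BorelSpace L]

/-- The topology of weak convergence of measures. -/
instance : TopologicalSpace (SubProb K) :=
  inferInstanceAs (TopologicalSpace {μ : FiniteMeasure K // μ.mass ≤ 1})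

instance : MeasurableSpace (SubProb K) := borel _

instance : BorelSpace (SubProb K) := ⟨rfl⟩

/-- The underlying measure. -/
noncomputable def toMeasure (μ : SubProb K) : Measure K := (μ.1 : Measure K)

instance (μ : SubProb K) : IsFiniteMeasure μ.toMeasure :=
  inferInstanceAs (IsFiniteMeasure (μ.1 : Measure K))

/-- The push-forward map `f_*` induced by a continuous map `f`. -/
noncomputable def map (f : C(K, L)) : C(SubProb K, SubProb L) where
  toFun μ := ⟨μ.1.map f, (FiniteMeasure.mass_map_le f μ.1).trans μ.2⟩
  continuous_toFun := Continuous.subtype_mk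
    ((FiniteMeasure.continuous_map f.continuous).comp continuous_subtype_val) _

theorem toMeasure_map (f : C(K, L)) (μ : SubProb K) :
    (map f μ).toMeasure = μ.toMeasure.map f := rfl

theorem ext {μ ν : SubProb K} (h : μ.toMeasure = ν.toMeasure) : μ = ν :=
  Subtype.ext (Subtype.ext h)

theorem map_id (μ : SubProb K) : map (ContinuousMap.id K) μ = μ :=
  ext (by rw [toMeasure_map]; exact Measure.map_id)

theorem map_map {N : Type} [TopologicalSpace N] [MeasurableSpace N] [BorelSpace N]
    (g : C(L, N)) (f : C(K, L)) (μ : SubProb K) : map g (map f μ) = map (g.comp f) μ :=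
  ext (by
    simp only [toMeasure_map]
    exact Measure.map_map g.continuous.measurable f.continuous.measurable)

theorem toMeasure_univ_le (μ : SubProb K) : μ.toMeasure Set.univ ≤ 1 := by
  have h := μ.2
  rw [← ENNReal.coe_le_coe, FiniteMeasure.ennreal_mass] at h
  exact h

noncomputable instance : Zero (SubProb K) := ⟨⟨0, by simp⟩⟩

theorem toMeasure_zero : (0 : SubProb K).toMeasure = 0 := rfl

theorem map_zero (f : C(K, L)) : map f 0 = 0 :=
  ext (by rw [toMeasure_map, toMeasure_zero, toMeasure_zero, Measure.map_zero])

instance [T2Space K] [CompactSpace K] : CompactSpace (SubProb K) :=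
  isCompact_iff_compactSpace.1
    (isCompact_setOfPred_finiteMeasure_le_of_compactSpace K 1)

instance [HasOuterApproxClosed K] : T2Space (SubProb K) :=
  inferInstanceAs (T2Space {μ : FiniteMeasure K // μ.mass ≤ 1})

instance [CompactSpace K] [TopologicalSpace.MetrizableSpace K] :
    TopologicalSpace.MetrizableSpace (SubProb K) := by
  let _ := TopologicalSpace.metrizableSpaceMetric K
  let u : ℕ → C(K, ℝ) := TopologicalSpace.denseSeq C(K, ℝ)
  let Φ : SubProb K → (ℕ → ℝ) := fun μ n => ∫ x, u n x ∂(μ.1 : Measure K)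
  have hc : Continuous Φ := continuous_pi fun n =>
    (FiniteMeasure.continuous_integral_continuousMap (u n)).comp continuous_subtype_val
  have hcont : ∀ μ : SubProb K, Continuous fun f : C(K, ℝ) => ∫ x, f x ∂(μ.1 : Measure K) := by
    intro μ
    have h1 : (fun f : C(K, ℝ) => ∫ x, f x ∂(μ.1 : Measure K)) =
        fun f => ∫ x, ContinuousMap.toLp (E := ℝ) 1 (μ.1 : Measure K) ℝ f x
          ∂(μ.1 : Measure K) := by
      funext f
      exact (integral_congr_ae (ContinuousMap.coeFn_toLp (μ.1 : Measure K) f)).symm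
    rw [h1]
    exact continuous_integral.comp (ContinuousMap.toLp (E := ℝ) 1 (μ.1 : Measure K) ℝ).continuous
  have hi : Function.Injective Φ := by
    intro μ ν h
    have h2 : (fun f : C(K, ℝ) => ∫ x, f x ∂(μ.1 : Measure K)) =
        fun f => ∫ x, f x ∂(ν.1 : Measure K) :=
      (TopologicalSpace.denseRange_denseSeq C(K, ℝ)).equalizer (hcont μ) (hcont ν)
        (by funext n; exact congrFun h n)
    refine Subtype.ext (FiniteMeasure.ext_of_forall_integral_eq fun f => ?_)
    exact congrFun h2 f.toContinuousMap
  exact (hc.isClosedEmbedding hi).isEmbedding.metrizableSpace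

theorem measurable_apply [TopologicalSpace.MetrizableSpace K] :
    Measurable (toMeasure : SubProb K → Measure K) := by
  have hfin : ∀ μ : SubProb K, IsFiniteMeasure μ.toMeasure := fun μ => inferInstance
  have hF : ∀ F : Set K, IsClosed F → Measurable fun μ : SubProb K => μ.toMeasure F := by
    intro F hF
    refine measurable_of_tendsto_metrizable (f := fun n (μ : SubProb K) =>
      ∫⁻ x, (hF.apprSeq n x : ℝ≥0∞) ∂μ.toMeasure) (fun n => ?_) ?_
    · have h1 : Continuous fun μ : SubProb K =>
          ∫⁻ x, (hF.apprSeq n x : ℝ≥0∞) ∂(μ.1 : Measure K) :=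
        (FiniteMeasure.continuous_lintegral_boundedContinuousFunction
          (hF.apprSeq n)).comp continuous_subtype_val
      exact h1.measurable
    · exact tendsto_pi_nhds.2 fun μ =>
        HasOuterApproxClosed.tendsto_lintegral_apprSeq hF μ.toMeasure
  refine Measurable.measure_of_isPiSystem (S := {s | IsClosed s}) ?_ isPiSystem_isClosed
    (fun s hs => hF s hs) (hF _ isClosed_univ)
  rw [BorelSpace.measurable_eq (α := K), borel_eq_generateFrom_isClosed]

end

end SubProb

/-- A type with a topology and its Borel `σ`-algebra. -/
structure BorelType where
  carrier : Type
  [top : TopologicalSpace carrier]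
  [meas : MeasurableSpace carrier]
  [borel : BorelSpace carrier]

attribute [instance] BorelType.top BorelType.meas BorelType.borel

/-- The iterated measure spaces: `M₀` is a point and `M_{r+1}` is the space of Borel
sub-probability measures on `M_r`. -/
noncomputable def iterType : ℕ → BorelType
  | 0 => { carrier := PUnit, borel := ⟨borel_eq_top_of_discrete.symm⟩ }
  | r + 1 => { carrier := SubProb (iterType r).carrier }

/-- The space `M_r`. -/
abbrev IterSpace (r : ℕ) : Type := (iterType r).carrier

instance : Subsingleton (IterSpace 0) := inferInstanceAs (Subsingleton PUnit)

/-- The unique point of `M₀`. -/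
def IterSpace.point : IterSpace 0 := PUnit.unit

theorem IterSpace.compact_metrizable (r : ℕ) :
    CompactSpace (IterSpace r) ∧ TopologicalSpace.MetrizableSpace (IterSpace r) := by
  induction r with
  | zero => exact ⟨inferInstanceAs (CompactSpace PUnit), inferInstanceAs
      (TopologicalSpace.MetrizableSpace PUnit)⟩
  | succ r ih =>
    have := ih.1
    have := ih.2
    exact ⟨inferInstanceAs (CompactSpace (SubProb (IterSpace r))),
      inferInstanceAs (TopologicalSpace.MetrizableSpace (SubProb (IterSpace r)))⟩

instance (r : ℕ) : CompactSpace (IterSpace r) := (IterSpace.compact_metrizable r).1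

instance (r : ℕ) : TopologicalSpace.MetrizableSpace (IterSpace r) :=
  (IterSpace.compact_metrizable r).2

/-- The connecting maps `f_r : M_{r+1} → M_r`: `f₀` is the unique map to the point, and
`f_{r+1} = (f_r)_*`. -/
noncomputable def connect : (r : ℕ) → C(IterSpace (r + 1), IterSpace r)
  | 0 => ContinuousMap.const _ IterSpace.point
  | r + 1 => SubProb.map (connect r)

/-- The space `M` of consistent sequences `(σ_r)`, `f_r (σ_{r+1}) = σ_r`, with the topology
induced from the product. -/
def ConsistentSpace : Type :=
  {σ : (r : ℕ) → IterSpace r // ∀ r, connect r (σ (r + 1)) = σ r}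

namespace ConsistentSpace

instance : TopologicalSpace ConsistentSpace :=
  inferInstanceAs (TopologicalSpace
    {σ : (r : ℕ) → IterSpace r // ∀ r, connect r (σ (r + 1)) = σ r})

instance : MeasurableSpace ConsistentSpace := borel _

instance : BorelSpace ConsistentSpace := ⟨rfl⟩

instance : CompactSpace ConsistentSpace := by
  refine isCompact_iff_compactSpace.1 (IsClosed.isCompact ?_)
  have h : {σ : (r : ℕ) → IterSpace r | ∀ r, connect r (σ (r + 1)) = σ r} =
      ⋂ r, {σ | connect r (σ (r + 1)) = σ r} := by
    ext σ
    simp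
  change IsClosed {σ : (r : ℕ) → IterSpace r | ∀ r, connect r (σ (r + 1)) = σ r}
  rw [h]
  refine isClosed_iInter fun r => isClosed_eq ?_ (continuous_apply r)
  exact (connect r).continuous.comp (continuous_apply (r + 1))

instance : TopologicalSpace.MetrizableSpace ConsistentSpace :=
  (Topology.IsEmbedding.subtypeVal
    (p := fun σ : (r : ℕ) → IterSpace r => ∀ r, connect r (σ (r + 1)) = σ r)).metrizableSpace

/-- The coordinate `σ ↦ σ_r`. -/
def proj (r : ℕ) : C(ConsistentSpace, IterSpace r) :=
  ⟨fun σ => σ.1 r, (continuous_apply r).comp continuous_subtype_val⟩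

/-- The coordinate `σ_{r+1}`, as a measure on `M_r`. -/
noncomputable def marginal (σ : ConsistentSpace) (r : ℕ) : SubProb (IterSpace r) :=
  proj (r + 1) σ

theorem connect_proj (r : ℕ) (σ : ConsistentSpace) :
    connect r (proj (r + 1) σ) = proj r σ := σ.2 r

theorem map_connect_marginal (σ : ConsistentSpace) (r : ℕ) :
    SubProb.map (connect r) (marginal σ (r + 1)) = marginal σ r := σ.2 (r + 1)

theorem connect_comp_proj (r : ℕ) : (connect r).comp (proj (r + 1)) = proj r :=
  ContinuousMap.ext fun σ => connect_proj r σ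

/-- The sequence of marginals of a measure on `M`. -/
noncomputable def ofMeasureSeq (μ : SubProb ConsistentSpace) : (r : ℕ) → IterSpace r
  | 0 => IterSpace.point
  | r + 1 => (SubProb.map (proj r) μ : SubProb (IterSpace r))

/-- The consistent sequence of marginals of a measure on `M`. -/
noncomputable def ofMeasure : C(SubProb ConsistentSpace, ConsistentSpace) where
  toFun μ := ⟨ofMeasureSeq μ, fun r => by
    cases r with
    | zero => exact Subsingleton.elim _ _
    | succ r =>
      change SubProb.map (connect r) (SubProb.map (proj (r + 1)) μ) = SubProb.map (proj r) μ
      rw [SubProb.map_map, connect_comp_proj]⟩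
  continuous_toFun := Continuous.subtype_mk (continuous_pi fun r => by
    cases r with
    | zero => exact continuous_const
    | succ r => exact (SubProb.map (proj r)).continuous) _

theorem marginal_ofMeasure (μ : SubProb ConsistentSpace) (r : ℕ) :
    marginal (ofMeasure μ) r = SubProb.map (proj r) μ := rfl

/-- A continuous section of the projection `M → M_r`. -/
noncomputable def lift : (r : ℕ) → C(IterSpace r, ConsistentSpace)
  | 0 => ContinuousMap.const _ (ofMeasure 0)
  | r + 1 => ofMeasure.comp (SubProb.map (lift r))

theorem proj_comp_lift (r : ℕ) : (proj r).comp (lift r) = ContinuousMap.id _ := by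
  induction r with
  | zero => exact ContinuousMap.ext fun x => Subsingleton.elim _ _
  | succ r ih =>
    refine ContinuousMap.ext fun (μ : SubProb (IterSpace r)) => ?_
    have h : SubProb.map (proj r) (SubProb.map (lift r) μ) = μ := by
      rw [SubProb.map_map, ih, SubProb.map_id]
    exact h

theorem map_proj_map_lift (σ : ConsistentSpace) (k m : ℕ) :
    SubProb.map (proj k) (SubProb.map (lift (k + m)) (marginal σ (k + m))) = marginal σ k := by
  induction m generalizing k with
  | zero =>
    rw [SubProb.map_map]
    change SubProb.map ((proj k).comp (lift k)) (marginal σ k) = _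
    rw [proj_comp_lift, SubProb.map_id]
  | succ m ih =>
    have h := ih (k + 1)
    rw [show k + 1 + m = k + (m + 1) by omega] at h
    rw [← connect_comp_proj, ← SubProb.map_map, h, map_connect_marginal]

/-- Every consistent sequence is the sequence of marginals of a measure on `M`. -/
theorem exists_measure (σ : ConsistentSpace) :
    ∃ μ : SubProb ConsistentSpace, ∀ r, SubProb.map (proj r) μ = marginal σ r := by
  obtain ⟨μ, hμ⟩ := exists_clusterPt_of_compactSpace
    (map (fun r => SubProb.map (lift r) (marginal σ r)) atTop)
  refine ⟨μ, fun k => ?_⟩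
  have h1 : ClusterPt (SubProb.map (proj k) μ)
      (map (SubProb.map (proj k)) (map (fun r => SubProb.map (lift r) (marginal σ r)) atTop)) :=
    hμ.map (SubProb.map (proj k)).continuous.continuousAt tendsto_map
  have h2 : Tendsto (SubProb.map (proj k))
      (map (fun r => SubProb.map (lift r) (marginal σ r)) atTop) (𝓝 (marginal σ k)) := by
    rw [tendsto_map'_iff]
    refine tendsto_const_nhds.congr' ?_
    filter_upwards [eventually_ge_atTop k] with r hr
    obtain ⟨m, rfl⟩ := Nat.exists_eq_add_of_le hr
    exact (map_proj_map_lift σ k m).symm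
  exact eq_of_nhds_neBot (ClusterPt.mono h1 h2)

theorem measurableSpace_eq :
    (inferInstance : MeasurableSpace ConsistentSpace) = MeasurableSpace.generateFrom
      {s | ∃ (r : ℕ) (A : Set (IterSpace r)), MeasurableSet A ∧ proj r ⁻¹' A = s} := by
  have h : (inferInstance : MeasurableSpace ConsistentSpace) =
      MeasurableSpace.comap Subtype.val MeasurableSpace.pi :=
    (BorelSpace.measurable_eq (α := {σ : (r : ℕ) → IterSpace r //
      ∀ r, connect r (σ (r + 1)) = σ r})).symm
  refine le_antisymm ?_ (MeasurableSpace.generateFrom_le ?_)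
  · rw [h, MeasurableSpace.pi, MeasurableSpace.comap_iSup]
    refine iSup_le fun r => ?_
    rw [MeasurableSpace.comap_comp]
    rintro s ⟨A, hA, rfl⟩
    exact MeasurableSpace.measurableSet_generateFrom ⟨r, A, hA, rfl⟩
  · rintro s ⟨r, A, hA, rfl⟩
    exact (proj r).continuous.measurable hA

theorem cylinder_shift {r n : ℕ} (h : r ≤ n) {A : Set (IterSpace r)} (hA : MeasurableSet A) :
    ∃ B : Set (IterSpace n), MeasurableSet B ∧ proj n ⁻¹' B = proj r ⁻¹' A := by
  induction n, h using Nat.le_induction with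
  | base => exact ⟨A, hA, rfl⟩
  | succ n _ ih =>
    obtain ⟨B, hB, h⟩ := ih
    refine ⟨connect n ⁻¹' B, (connect n).continuous.measurable hB, ?_⟩
    rw [← h, ← connect_comp_proj n]
    rfl

theorem isPiSystem_cylinder : IsPiSystem
    {s | ∃ (r : ℕ) (A : Set (IterSpace r)), MeasurableSet A ∧ proj r ⁻¹' A = s} := by
  rintro _ ⟨r, A, hA, rfl⟩ _ ⟨k, B, hB, rfl⟩ -
  obtain ⟨A', hA', h1⟩ := cylinder_shift (le_max_left r k) hA
  obtain ⟨B', hB', h2⟩ := cylinder_shift (le_max_right r k) hB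
  exact ⟨max r k, A' ∩ B', hA'.inter hB', by rw [← h1, ← h2, Set.preimage_inter]⟩

/-- The measure on `M` extending the marginals `σ_{r+1}` of the consistent sequence `σ`. -/
noncomputable def degMeasure (σ : ConsistentSpace) : SubProb ConsistentSpace :=
  (exists_measure σ).choose

theorem degMeasure_cylinder (σ : ConsistentSpace) (r : ℕ) {A : Set (IterSpace r)}
    (hA : MeasurableSet A) :
    (degMeasure σ).toMeasure (proj r ⁻¹' A) = (marginal σ r).toMeasure A := by
  rw [← (exists_measure σ).choose_spec r, SubProb.toMeasure_map,
    Measure.map_apply (proj r).continuous.measurable hA]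
  rfl

theorem measurable_degMeasure :
    Measurable fun σ : ConsistentSpace => (degMeasure σ).toMeasure := by
  refine Measurable.measure_of_isPiSystem measurableSpace_eq isPiSystem_cylinder ?_ ?_
  · rintro _ ⟨r, A, hA, rfl⟩
    simp only [degMeasure_cylinder _ r hA]
    exact (Measure.measurable_coe hA).comp
      (SubProb.measurable_apply.comp (proj (r + 1)).continuous.measurable)
  · have h : ∀ σ : ConsistentSpace, (degMeasure σ).toMeasure Set.univ =
        (marginal σ 0).toMeasure Set.univ := fun σ =>
      degMeasure_cylinder σ 0 MeasurableSet.univ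
    simp only [h]
    exact (Measure.measurable_coe MeasurableSet.univ).comp
      (SubProb.measurable_apply.comp (proj 1).continuous.measurable)

/-- The canonical sub-Markov kernel on `M`. -/
noncomputable def deg : Kernel ConsistentSpace ConsistentSpace where
  toFun σ := (degMeasure σ).toMeasure
  measurable' := measurable_degMeasure

theorem deg_cylinder (σ : ConsistentSpace) (r : ℕ) {A : Set (IterSpace r)}
    (hA : MeasurableSet A) :
    deg σ (proj r ⁻¹' A) = SubProb.toMeasure (K := IterSpace r) (σ.1 (r + 1)) A :=
  degMeasure_cylinder σ r hA

theorem deg_univ_le (σ : ConsistentSpace) : deg σ Set.univ ≤ 1 :=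
  (degMeasure σ).toMeasure_univ_le

/-- The kernel is determined by its values on cylinder sets. -/
theorem deg_unique (κ : Kernel ConsistentSpace ConsistentSpace)
    (h : ∀ (σ : ConsistentSpace) (r : ℕ) (A : Set (IterSpace r)), MeasurableSet A →
      κ σ (proj r ⁻¹' A) = SubProb.toMeasure (K := IterSpace r) (σ.1 (r + 1)) A) :
    κ = deg := by
  refine Kernel.ext fun σ => ?_
  have hu : deg σ Set.univ = κ σ Set.univ :=
    (deg_cylinder σ 0 MeasurableSet.univ).trans (h σ 0 _ MeasurableSet.univ).symm
  have : IsFiniteMeasure (deg σ) := ⟨(deg_univ_le σ).trans_lt ENNReal.one_lt_top⟩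
  refine (ext_of_generate_finite _ measurableSpace_eq isPiSystem_cylinder ?_ hu).symm
  rintro _ ⟨r, A, hA, rfl⟩
  rw [deg_cylinder σ r hA, h σ r A hA]

end ConsistentSpace

section Trees

variable {W : Type} (F : SimpleGraph W)

/-- The nodes of a rooted labelled tree, in decreasing order of labels; `o` has label `0`. -/
def nodes (o : W) (R : List (W × W)) : List W := R.map Prod.fst ++ [o]

/-- Admissible labellings: `R` lists, in decreasing order of labels, the pairs `(i, j(i))` where
`i` is a node other than the root `o` and `j(i)` is a node with smaller label that is adjacent
to `i`. -/
inductive Admissible (o : W) : List (W × W) → Prop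
  | nil : Admissible o []
  | cons (i j : W) (R : List (W × W)) (hR : Admissible o R) (hi : i ∉ nodes o R)
      (hj : j ∈ nodes o R) (hij : F.Adj i j) : Admissible o ((i, j) :: R)

/-- An admissible labelling of all the nodes of `F`, with the choice of the function `j`. -/
structure AdmissibleLabeling where
  root : W
  rest : List (W × W)
  admissible : Admissible F root rest
  total : ∀ w, w ∈ nodes root rest

variable {F}

theorem mem_nodes_cons {o i j w : W} {R : List (W × W)} :
    w ∈ nodes o ((i, j) :: R) ↔ w = i ∨ w ∈ nodes o R := by
  simp [nodes]

theorem mem_nodes_nil {o w : W} : w ∈ nodes o [] ↔ w = o := by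
  simp [nodes]

theorem Admissible.of_cons {o i j : W} {R : List (W × W)} (h : Admissible F o ((i, j) :: R)) :
    Admissible F o R ∧ i ∉ nodes o R ∧ j ∈ nodes o R ∧ F.Adj i j := by
  cases h with
  | cons _ _ _ hR hi hj hij => exact ⟨hR, hi, hj, hij⟩

theorem Admissible.nodup {o : W} {R : List (W × W)} (h : Admissible F o R) :
    (nodes o R).Nodup := by
  induction h with
  | nil => simp [nodes]
  | cons i j R _ hi _ _ ih => exact List.nodup_cons.2 ⟨hi, ih⟩

theorem root_mem_nodes (o : W) (R : List (W × W)) : o ∈ nodes o R := by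
  simp [nodes]

theorem length_nodes (o : W) (R : List (W × W)) : (nodes o R).length = R.length + 1 := by
  simp [nodes]

/-- Every tree has an admissible labelling. -/
theorem nonempty_admissibleLabeling [Finite W] (hF : F.IsTree) :
    Nonempty (AdmissibleLabeling F) := by
  have := Fintype.ofFinite W
  have := hF.1.nonempty
  let o : W := Classical.arbitrary W
  by_contra hne
  have key : ∀ n, ∃ R, Admissible F o R ∧ R.length = n := by
    intro n
    induction n with
    | zero => exact ⟨[], .nil, rfl⟩
    | succ n ih =>
      obtain ⟨R, hR, hn⟩ := ih
      have h1 : ∃ w, w ∉ nodes o R := by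
        by_contra! h
        exact hne ⟨⟨o, R, hR, h⟩⟩
      obtain ⟨w, hw⟩ := h1
      obtain ⟨p⟩ := hF.1.preconnected o w
      obtain ⟨d, _, hd1, hd2⟩ := p.exists_boundary_dart {w | w ∈ nodes o R}
        (root_mem_nodes o R) hw
      exact ⟨(d.snd, d.fst) :: R, .cons _ _ _ hR hd2 hd1 d.adj.symm, by simp [hn]⟩
  obtain ⟨R, hR, hn⟩ := key (Fintype.card W)
  have := hR.nodup.length_le_card
  rw [length_nodes] at this
  omega

/-- Two nodes of an admissible list are joined by a walk inside the list. -/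
theorem Admissible.exists_walk {o : W} {R : List (W × W)} (h : Admissible F o R) :
    ∀ w ∈ nodes o R, ∃ p : F.Walk w o, ∀ u ∈ p.support, u ∈ nodes o R := by
  induction h with
  | nil =>
    intro w hw
    obtain rfl := mem_nodes_nil.1 hw
    exact ⟨.nil, by simp [nodes]⟩
  | cons i j R _ _ hj hij ih =>
    intro w hw
    rcases mem_nodes_cons.1 hw with rfl | hw
    · obtain ⟨p, hp⟩ := ih j hj
      refine ⟨.cons hij p, fun u hu => ?_⟩
      rw [SimpleGraph.Walk.support_cons, List.mem_cons] at hu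
      exact mem_nodes_cons.2 (hu.imp_right (hp u))
    · obtain ⟨p, hp⟩ := ih w hw
      exact ⟨p, fun u hu => mem_nodes_cons.2 (Or.inr (hp u hu))⟩

/-- In an acyclic graph, a node outside an admissible list has at most one neighbour in it. -/
theorem Admissible.eq_of_adj (hF : F.IsAcyclic) {o : W} {R : List (W × W)}
    (h : Admissible F o R) {i a b : W} (hi : i ∉ nodes o R) (ha : a ∈ nodes o R)
    (hb : b ∈ nodes o R) (hia : F.Adj i a) (hib : F.Adj i b) : a = b := by
  classical
  obtain ⟨p, hp⟩ := h.exists_walk a ha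
  obtain ⟨q, hq⟩ := h.exists_walk b hb
  let r : F.Path a b := (p.append q.reverse).toPath
  have hr : i ∉ (r : F.Walk a b).support := by
    intro hmem
    have h1 := SimpleGraph.Walk.support_toPath_subset_support (p.append q.reverse) hmem
    rw [SimpleGraph.Walk.mem_support_append_iff, SimpleGraph.Walk.support_reverse,
      List.mem_reverse] at h1
    exact hi (h1.elim (hp i) (hq i))
  have := hF.subsingleton_path i b
  have h2 : (⟨.cons hia r, r.2.cons hr⟩ : F.Path i b) = SimpleGraph.Path.singleton hib :=
    Subsingleton.elim _ _
  have h3 := congrArg (fun P : F.Path i b => (P : F.Walk i b).snd) h2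
  simpa using h3

theorem Admissible.exists_adj {o : W} {R : List (W × W)} (h : Admissible F o R) (hR : R ≠ []) :
    ∀ v ∈ nodes o R, ∃ u ∈ nodes o R, F.Adj v u := by
  induction h with
  | nil => exact absurd rfl hR
  | cons i j R _ _ hj hij ih =>
    intro v hv
    rcases mem_nodes_cons.1 hv with rfl | hv
    · exact ⟨j, mem_nodes_cons.2 (Or.inr hj), hij⟩
    · by_cases hR' : R = []
      · subst hR'
        rw [mem_nodes_nil] at hv hj
        subst hv hj
        exact ⟨i, mem_nodes_cons.2 (Or.inl rfl), hij.symm⟩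
      · obtain ⟨u, hu, huv⟩ := ih hR' v hv
        exact ⟨u, mem_nodes_cons.2 (Or.inr hu), huv⟩

/-- A node with a single neighbour can be removed from an admissible list. -/
theorem Admissible.remove {o : W} {R : List (W × W)} (h : Admissible F o R) (hR : R ≠ [])
    {l : W} (hl : l ∈ nodes o R)
    (hu : ∀ u ∈ nodes o R, ∀ v ∈ nodes o R, F.Adj l u → F.Adj l v → u = v) :
    ∃ o' R', Admissible F o' R' ∧ l ∉ nodes o' R' ∧
      ∀ w, w ∈ nodes o R ↔ w = l ∨ w ∈ nodes o' R' := by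
  induction h with
  | nil => exact absurd rfl hR
  | cons i j R hA hi hj hij ih =>
    by_cases hli : l = i
    · subst hli
      exact ⟨o, R, hA, hi, fun w => mem_nodes_cons⟩
    have hlR : l ∈ nodes o R := (mem_nodes_cons.1 hl).resolve_left hli
    by_cases hR' : R = []
    · subst hR'
      rw [mem_nodes_nil] at hlR
      subst hlR
      refine ⟨i, [], .nil, fun h => hli (mem_nodes_nil.1 h), fun w => ?_⟩
      rw [mem_nodes_cons, mem_nodes_nil, mem_nodes_nil, or_comm]
    · obtain ⟨o', R', hA', hl', hw'⟩ := ih hR' hlR fun u hu1 v hv1 =>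
        hu u (mem_nodes_cons.2 (Or.inr hu1)) v (mem_nodes_cons.2 (Or.inr hv1))
      have hjl : j ≠ l := by
        rintro rfl
        obtain ⟨u, hu1, hu2⟩ := hA.exists_adj hR' j hj
        have := hu u (mem_nodes_cons.2 (Or.inr hu1)) i (mem_nodes_cons.2 (Or.inl rfl)) hu2 hij.symm
        exact hi (this ▸ hu1)
      have hi' : i ∉ nodes o' R' := fun h => hi ((hw' i).2 (Or.inr h))
      refine ⟨o', (i, j) :: R', .cons i j R' hA' hi' (((hw' j).1 hj).resolve_left hjl) hij, ?_, ?_⟩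
      · rw [mem_nodes_cons]
        exact not_or.2 ⟨hli, hl'⟩
      · intro w
        rw [mem_nodes_cons, mem_nodes_cons, hw' w]
        tauto

theorem Admissible.exists_cons {o : W} {R : List (W × W)} (h : Admissible F o R) (hR : R ≠ [])
    {l b : W} (hl : l ∈ nodes o R) (hb : b ∈ nodes o R) (hlb : F.Adj l b)
    (hu : ∀ u ∈ nodes o R, ∀ v ∈ nodes o R, F.Adj l u → F.Adj l v → u = v) :
    ∃ o' R', Admissible F o' ((l, b) :: R') ∧
      ∀ w, w ∈ nodes o R ↔ w ∈ nodes o' ((l, b) :: R') := by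
  obtain ⟨o', R', hA, hl', hw⟩ := h.remove hR hl hu
  exact ⟨o', R', .cons l b R' hA hl' (((hw b).1 hb).resolve_left hlb.ne') hlb,
    fun w => (hw w).trans mem_nodes_cons.symm⟩

variable {X : Type*} [MeasurableSpace X] (κ : Kernel X X)

open Classical in
/-- The iterated integral
`∫ ⋯ ∫ h(x) dκ(x_{j(n)})(x_n) ⋯ dκ(x_{j(1)})(x_1)` over the nodes of the list `R`. -/
noncomputable def iterIntegral : List (W × W) → ((W → X) → ℝ≥0∞) → (W → X) → ℝ≥0∞
  | [], h => h
  | (i, j) :: R, h =>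
    iterIntegral R fun x => ∫⁻ y, h (Function.update x i y) ∂κ (x j)

/-- The rooted density of a labelled tree at `x₀`. -/
noncomputable def rootedDensity (L : AdmissibleLabeling F) (x₀ : X) : ℝ≥0∞ :=
  iterIntegral κ L.rest (fun _ => 1) fun _ => x₀

/-- The density of a labelled tree. -/
noncomputable def labeledDensity (π : Measure X) (L : AdmissibleLabeling F) : ℝ≥0∞ :=
  ∫⁻ x, rootedDensity κ L x ∂π

/-- The density `t(F, (X, π, κ))` of a finite tree `F` in a probability space `(X, π)` with a
reversible sub-Markov kernel `κ`. It does not depend on the labelling of `F`, see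
`labeledDensity_eq`. -/
noncomputable def treeDensity [Finite W] (π : Measure X) (hF : F.IsTree) : ℝ≥0∞ :=
  labeledDensity κ π (nonempty_admissibleLabeling hF).some

/-- The integral with a weight at each node. -/
noncomputable def weighted (π : Measure X) (o : W) (R : List (W × W)) (g : W → X → ℝ≥0∞) :
    ℝ≥0∞ :=
  ∫⁻ x₀, iterIntegral κ R (fun x => ((nodes o R).map fun w => g w (x w)).prod) (fun _ => x₀) ∂π

open Classical in
/-- The weights after integrating out the node `i` with neighbour `j`. -/
noncomputable def absorb (i j : W) (g : W → X → ℝ≥0∞) : W → X → ℝ≥0∞ :=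
  Function.update g j fun x => g j x * ∫⁻ y, g i y ∂κ x

theorem measurable_absorb {i j : W} {g : W → X → ℝ≥0∞} (hg : ∀ w, Measurable (g w)) (w : W) :
    Measurable (absorb κ i j g w) := by
  classical
  unfold absorb
  by_cases h : w = j
  · subst h
    rw [Function.update_self]
    exact (hg w).mul (hg i).lintegral_kernel
  · rw [Function.update_of_ne h]
    exact hg w

theorem prod_absorb (i j : W) (g : W → X → ℝ≥0∞) (x : W → X) (S : List W) (hS : S.Nodup)
    (hj : j ∈ S) :
    (S.map fun w => absorb κ i j g w (x w)).prod =
      (S.map fun w => g w (x w)).prod * ∫⁻ y, g i y ∂κ (x j) := by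
  classical
  have h0 : ∀ S : List W, j ∉ S →
      (S.map fun w => absorb κ i j g w (x w)) = S.map fun w => g w (x w) := by
    intro S hS
    refine List.map_congr_left fun w hw => ?_
    have : w ≠ j := fun h => hS (h ▸ hw)
    rw [absorb, Function.update_of_ne this]
  induction S with
  | nil => simp at hj
  | cons a S ih =>
    rw [List.nodup_cons] at hS
    rw [List.map_cons, List.map_cons, List.prod_cons, List.prod_cons]
    by_cases ha : j = a
    · subst ha
      rw [h0 S hS.1, absorb, Function.update_self]
      ring
    · rw [ih hS.2 ((List.mem_cons.1 hj).resolve_left ha), absorb,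
        Function.update_of_ne (Ne.symm ha)]
      ring

theorem weighted_cons (π : Measure X) {o i j : W} {R : List (W × W)}
    (h : Admissible F o ((i, j) :: R)) {g : W → X → ℝ≥0∞} (hg : ∀ w, Measurable (g w)) :
    weighted κ π o ((i, j) :: R) g = weighted κ π o R (absorb κ i j g) := by
  classical
  obtain ⟨hR, hi, hj, hij⟩ := h.of_cons
  · unfold weighted
    refine lintegral_congr fun x₀ => ?_
    rw [iterIntegral]
    congr 1
    funext x
    rw [prod_absorb κ i j g x _ hR.nodup hj]
    have h1 : ∀ y, ((nodes o ((i, j) :: R)).map fun w => g w (Function.update x i y w)).prod =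
        ((nodes o R).map fun w => g w (x w)).prod * g i y := by
      intro y
      change ((i :: nodes o R).map fun w => g w (Function.update x i y w)).prod = _
      rw [List.map_cons, List.prod_cons, Function.update_self, mul_comm]
      congr 2
      refine List.map_congr_left fun w hw => ?_
      have : w ≠ i := fun h => hi (h ▸ hw)
      rw [Function.update_of_ne this]
    simp only [h1]
    rw [lintegral_const_mul _ (hg i)]

variable {κ}

theorem lintegral_swap_of_indicator {π : Measure X} {f g : X → ℝ≥0∞}
    (hf : Measurable f) (hg : Measurable g)
    (h : ∀ (c : ℝ≥0∞) (A : Set X), MeasurableSet A →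
      ∫⁻ x, A.indicator (fun _ => c) x * ∫⁻ y, g y ∂κ x ∂π =
        ∫⁻ x, g x * ∫⁻ y, A.indicator (fun _ => c) y ∂κ x ∂π) :
    ∫⁻ x, f x * ∫⁻ y, g y ∂κ x ∂π = ∫⁻ x, g x * ∫⁻ y, f y ∂κ x ∂π := by
  refine Measurable.ennreal_induction (motive := fun f : X → ℝ≥0∞ =>
    ∫⁻ x, f x * ∫⁻ y, g y ∂κ x ∂π = ∫⁻ x, g x * ∫⁻ y, f y ∂κ x ∂π)
    (fun c A hA => h c A hA) ?_ ?_ hf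
  · intro f₁ f₂ _ h1 h2 ih1 ih2
    simp only [Pi.add_apply]
    simp_rw [lintegral_add_left h1, mul_add, add_mul]
    rw [lintegral_add_left, lintegral_add_left, ih1, ih2]
    · exact hg.mul h1.lintegral_kernel
    · exact h1.mul hg.lintegral_kernel
  · intro f hf hmono ih
    have hm1 : ∀ x, Monotone fun n => f n x := fun x m n h => hmono h x
    simp_rw [lintegral_iSup hf hmono, ENNReal.mul_iSup, ENNReal.iSup_mul]
    rw [lintegral_iSup, lintegral_iSup]
    · exact iSup_congr ih
    · exact fun n => hg.mul (hf n).lintegral_kernel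
    · exact fun m n h x => mul_le_mul_right (lintegral_mono fun y => hm1 y h) _
    · exact fun n => (hf n).mul hg.lintegral_kernel
    · exact fun m n h x => mul_le_mul_left (hm1 x h) _

theorem reversible_lintegral {π : Measure X} (hκ : κ.IsReversible π) {f g : X → ℝ≥0∞}
    (hf : Measurable f) (hg : Measurable g) :
    ∫⁻ x, f x * ∫⁻ y, g y ∂κ x ∂π = ∫⁻ x, g x * ∫⁻ y, f y ∂κ x ∂π := by
  have h : ∀ (c d : ℝ≥0∞) (A B : Set X), MeasurableSet A → MeasurableSet B →
      ∫⁻ x, A.indicator (fun _ => c) x * ∫⁻ y, B.indicator (fun _ => d) y ∂κ x ∂π =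
        c * d * ∫⁻ x in A, κ x B ∂π := by
    intro c d A B hA hB
    rw [← lintegral_indicator hA, ← lintegral_const_mul _
      ((κ.measurable_coe hB).indicator hA)]
    refine lintegral_congr fun x => ?_
    rw [lintegral_indicator_const hB]
    by_cases hx : x ∈ A <;> simp [hx, mul_assoc]
  refine lintegral_swap_of_indicator hf hg fun c A hA => ?_
  refine (lintegral_swap_of_indicator hg (measurable_const.indicator hA) fun d B hB => ?_).symm
  rw [h c d A B hA hB, h d c B A hB hA, hκ hA hB, mul_comm c d]

theorem absorb_comm {i j k l : W} (hj : j ≠ k) (hl : l ≠ i) (g : W → X → ℝ≥0∞) :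
    absorb κ k l (absorb κ i j g) = absorb κ i j (absorb κ k l g) := by
  classical
  funext w x
  have h1 : absorb κ i j g k = g k := by rw [absorb, Function.update_of_ne (Ne.symm hj)]
  have h2 : absorb κ k l g i = g i := by rw [absorb, Function.update_of_ne (Ne.symm hl)]
  rw [absorb, absorb.eq_1 κ i j (absorb κ k l g), h1, h2]
  by_cases hlj : l = j
  · subst hlj
    by_cases hw : w = l
    · subst hw
      simp only [Function.update_self, absorb]
      ring
    · simp only [Function.update_of_ne hw, absorb]
  · by_cases hw : w = l
    · subst hw
      simp only [Function.update_self, Function.update_of_ne hlj, absorb]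
    · by_cases hw' : w = j
      · subst hw'
        simp only [Function.update_self, Function.update_of_ne hw, absorb]
      · simp only [Function.update_of_ne hw, Function.update_of_ne hw', absorb]

theorem iff_of_remove_two {p q a b c d : Prop} (h1 : p ∨ a ↔ q ∨ b) (h2 : a ↔ q ∨ c)
    (h3 : b ↔ p ∨ d) (ha : p → ¬a) (hb : q → ¬b) (hc : q → ¬c) (hd : p → ¬d) : c ↔ d := by
  by_cases hp : p <;> by_cases hq : q <;> simp_all

theorem weighted_eq {π : Measure X} (hκ : κ.IsReversible π) (hF : F.IsAcyclic) (n : ℕ) :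
    ∀ (o o' : W) (R R' : List (W × W)) (g : W → X → ℝ≥0∞), R.length ≤ n →
      Admissible F o R → Admissible F o' R' → (∀ w, w ∈ nodes o R ↔ w ∈ nodes o' R') →
      (∀ w, Measurable (g w)) → weighted κ π o R g = weighted κ π o' R' g := by
  induction n with
  | zero =>
    intro o o' R R' g hn hA hA' hw _
    have hlen := ((List.perm_ext_iff_of_nodup hA.nodup hA'.nodup).2 hw).length_eq
    rw [length_nodes, length_nodes] at hlen
    obtain rfl := List.length_eq_zero_iff.1 (Nat.le_zero.1 hn)
    obtain rfl := List.length_eq_zero_iff.1 (by simpa using hlen.symm : R'.length = 0)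
    obtain rfl := mem_nodes_nil.1 ((hw o).1 (mem_nodes_nil.2 rfl))
    rfl
  | succ n ih =>
    intro o o' R R' g hn hA hA' hw hg
    have hlen := ((List.perm_ext_iff_of_nodup hA.nodup hA'.nodup).2 hw).length_eq
    rw [length_nodes, length_nodes] at hlen
    obtain _ | ⟨⟨i, j⟩, R⟩ := R
    · exact ih _ _ _ _ _ (Nat.zero_le _) hA hA' hw hg
    obtain _ | ⟨⟨k, l⟩, R'⟩ := R'
    · simp at hlen
    simp only [List.length_cons, Nat.add_right_cancel_iff, Nat.add_le_add_iff_right] at hn hlen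
    rw [weighted_cons κ π hA hg, weighted_cons κ π hA' hg]
    obtain ⟨hR, hi, hj, hij⟩ := hA.of_cons
    obtain ⟨hR', hk, hl, hkl⟩ := hA'.of_cons
    by_cases hik : i = k
    · subst hik
      have hw' : ∀ w, w ∈ nodes o R ↔ w ∈ nodes o' R' := by
        intro w
        have h1 := hw w
        rw [mem_nodes_cons, mem_nodes_cons] at h1
        by_cases hwi : w = i
        · rw [hwi]
          exact iff_of_false hi hk
        · simpa [hwi] using h1
      obtain rfl := hR.eq_of_adj hF hi hj ((hw' l).2 hl) hij hkl
      exact ih _ _ _ _ _ hn hR hR' hw' (measurable_absorb κ hg)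
    · have hkR : k ∈ nodes o R :=
        (mem_nodes_cons.1 ((hw k).2 (mem_nodes_cons.2 (Or.inl rfl)))).resolve_left (Ne.symm hik)
      have hiR' : i ∈ nodes o' R' :=
        (mem_nodes_cons.1 ((hw i).1 (mem_nodes_cons.2 (Or.inl rfl)))).resolve_left hik
      by_cases hRe : R = []
      · subst hRe
        obtain rfl := List.length_eq_zero_iff.1 (by simpa using hlen.symm : R'.length = 0)
        rw [mem_nodes_nil] at hj hl hkR hiR'
        subst hj hl hkR hiR'
        have h1 : ∀ (a b : W), weighted κ π a [] (absorb κ b a g) =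
            ∫⁻ x, g a x * ∫⁻ y, g b y ∂κ x ∂π := by
          intro a b
          simp [weighted, iterIntegral, nodes, absorb]
        rw [h1, h1]
        exact reversible_lintegral hκ (hg _) (hg _)
      · have hR'e : R' ≠ [] := by
          rintro rfl
          exact hRe (List.length_eq_zero_iff.1 (by simpa using hlen))
        -- the nodes `i` and `k` are leaves
        have hi1 : ∀ u ∈ nodes o' R', ∀ v ∈ nodes o' R', F.Adj i u → F.Adj i v → u = v := by
          have h1 : ∀ u ∈ nodes o' R', F.Adj i u → u ∈ nodes o R := fun u hu h =>
            (mem_nodes_cons.1 ((hw u).2 (mem_nodes_cons.2 (Or.inr hu)))).resolve_left h.ne'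
          exact fun u hu v hv h2 h3 => hR.eq_of_adj hF hi (h1 u hu h2) (h1 v hv h3) h2 h3
        have hk1 : ∀ u ∈ nodes o R, ∀ v ∈ nodes o R, F.Adj k u → F.Adj k v → u = v := by
          have h1 : ∀ u ∈ nodes o R, F.Adj k u → u ∈ nodes o' R' := fun u hu h =>
            (mem_nodes_cons.1 ((hw u).1 (mem_nodes_cons.2 (Or.inr hu)))).resolve_left h.ne'
          exact fun u hu v hv h2 h3 => hR'.eq_of_adj hF hk (h1 u hu h2) (h1 v hv h3) h2 h3
        have hjk : j ≠ k := by
          rintro rfl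
          obtain ⟨u, hu, huj⟩ := hR.exists_adj hRe j hj
          have hu' : u ∈ nodes o' R' :=
            (mem_nodes_cons.1 ((hw u).1 (mem_nodes_cons.2 (Or.inr hu)))).resolve_left huj.ne'
          exact hi ((hR'.eq_of_adj hF hk hu' hiR' huj hij.symm) ▸ hu)
        have hli : l ≠ i := by
          rintro rfl
          obtain ⟨u, hu, huj⟩ := hR'.exists_adj hR'e l hl
          have hu' : u ∈ nodes o R :=
            (mem_nodes_cons.1 ((hw u).2 (mem_nodes_cons.2 (Or.inr hu)))).resolve_left huj.ne'
          exact hk ((hR.eq_of_adj hF hi hu' hkR huj hkl.symm) ▸ hu)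
        have hlR : l ∈ nodes o R :=
          (mem_nodes_cons.1 ((hw l).2 (mem_nodes_cons.2 (Or.inr hl)))).resolve_left hli
        have hjR' : j ∈ nodes o' R' :=
          (mem_nodes_cons.1 ((hw j).1 (mem_nodes_cons.2 (Or.inr hj)))).resolve_left hjk
        obtain ⟨o₂, R₂, hA₂, hw₂⟩ := hR.exists_cons hRe hkR hlR hkl hk1
        obtain ⟨o₃, R₃, hA₃, hw₃⟩ := hR'.exists_cons hR'e hiR' hjR' hij hi1
        have hm := measurable_absorb κ (i := i) (j := j) hg
        have hm' := measurable_absorb κ (i := k) (j := l) hg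
        rw [ih _ _ _ _ _ hn hR hA₂ hw₂ hm, ih _ _ _ _ _ (by omega) hR' hA₃ hw₃ hm',
          weighted_cons κ π hA₂ hm, weighted_cons κ π hA₃ hm', absorb_comm hjk hli]
        have hl₂ := ((List.perm_ext_iff_of_nodup hR.nodup hA₂.nodup).2 hw₂).length_eq
        rw [length_nodes, length_nodes, List.length_cons] at hl₂
        obtain ⟨hR₂, hk₂, _, _⟩ := hA₂.of_cons
        obtain ⟨hR₃, hi₃, _, _⟩ := hA₃.of_cons
        have hw23 : ∀ w, w ∈ nodes o₂ R₂ ↔ w ∈ nodes o₃ R₃ := by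
          intro w
          have h1 := hw w
          have h2 := hw₂ w
          have h3 := hw₃ w
          rw [mem_nodes_cons] at h2 h3
          rw [mem_nodes_cons, mem_nodes_cons] at h1
          exact iff_of_remove_two h1 h2 h3 (fun h => h ▸ hi) (fun h => h ▸ hk)
            (fun h => h ▸ hk₂) (fun h => h ▸ hi₃)
        exact ih _ _ _ _ _ (by omega) hR₂ hR₃ hw23 (measurable_absorb κ hm')

/-- The density of a tree does not depend on the labelling, in particular not on the root. -/
theorem labeledDensity_eq {π : Measure X} (hκ : κ.IsReversible π) (hF : F.IsAcyclic)
    (L L' : AdmissibleLabeling F) : labeledDensity κ π L = labeledDensity κ π L' := by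
  have h : ∀ L : AdmissibleLabeling F,
      labeledDensity κ π L = weighted κ π L.root L.rest fun _ _ => 1 := by
    intro L
    simp [labeledDensity, rootedDensity, weighted]
  rw [h, h]
  exact weighted_eq hκ hF _ _ _ _ _ _ le_rfl L.admissible L'.admissible
    (fun w => iff_of_true (L.total w) (L'.total w)) fun _ => measurable_const

theorem treeDensity_eq [Finite W] {π : Measure X} (hκ : κ.IsReversible π) (hF : F.IsTree)
    (L : AdmissibleLabeling F) : treeDensity κ π hF = labeledDensity κ π L :=
  labeledDensity_eq hκ hF.2 _ _

theorem iterIntegral_le_one (hκ : ∀ x, κ x Set.univ ≤ 1) (R : List (W × W))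
    (h : (W → X) → ℝ≥0∞) (hh : ∀ x, h x ≤ 1) (x : W → X) : iterIntegral κ R h x ≤ 1 := by
  induction R generalizing h with
  | nil => exact hh x
  | cons e R ih =>
    obtain ⟨i, j⟩ := e
    refine ih _ fun x => ?_
    calc _ ≤ ∫⁻ _, 1 ∂κ (x j) := lintegral_mono fun y => hh _
      _ ≤ 1 := by simpa using hκ (x j)

theorem treeDensity_le_one [Finite W] (hκ : ∀ x, κ x Set.univ ≤ 1) (π : Measure X)
    [IsProbabilityMeasure π] (hF : F.IsTree) : treeDensity κ π hF ≤ 1 := by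
  calc treeDensity κ π hF ≤ ∫⁻ _, 1 ∂π :=
        lintegral_mono fun x => iterIntegral_le_one hκ _ _ (fun _ => le_rfl) _
    _ ≤ 1 := by simp

end Trees

/-- `(G, d)` is an admissible pair: `d ≥ 1` and all degrees of `G` are at most `d`. -/
def IsAdmissiblePair {V : Type*} (G : SimpleGraph V) (d : ℝ) : Prop :=
  1 ≤ d ∧ ∀ v, ((G.neighborSet v).ncard : ℝ) ≤ d

/-- The homomorphism density `t(F, G, d) = hom(F, G) / (|V(G)| d ^ (|V(F)| - 1))` of a finite
connected graph `F` in `(G, d)`. -/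
noncomputable def homDensity {W : Type} {V : Type*} (F : SimpleGraph W) (G : SimpleGraph V)
    (d : ℝ) : ℝ :=
  (Nat.card (F →g G) : ℝ) / ((Nat.card V : ℝ) * d ^ (Nat.card W - 1))

end GraphLimit

/-!
The densities `t(F, G, d)` are iterated integrals of the kernel that gives mass `1 / d` to each
neighbor of a vertex. Sending a vertex to the consistent sequence of its iterated neighborhood
distributions maps this kernel to `deg`, so the push-forward of the uniform measure on the vertices
is involution-invariant and has the same densities as `(G, d)`. Since `deg` is a Feller kernel, the
involution-invariant probability measures on `M` form a weakly closed set on which the densities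
are continuous; hence any cluster point of the push-forwards is the required limit.

For uniqueness, let `P` be the operator `g ↦ ∫ g d deg(·)`. Joining the root of `F` to the root of
`F'` by an edge multiplies the rooted density of `F` by `P` applied to that of `F'`. Therefore the
linear span of the rooted densities contains a `P`-invariant algebra. By Stone–Weierstrass,
applied to one coordinate `M_r` after another, such an algebra is dense in `C(M)`, because
`P (φ ∘ proj r)` is the integral of `φ` against the coordinate `r + 1`.
-/

namespace GraphLimit

section Labelings

variable {W W' : Type} {F : SimpleGraph W} {F' : SimpleGraph W'}

theorem nodes_map (f : W → W') (o : W) (R : List (W × W)) :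
    nodes (f o) (R.map (Prod.map f f)) = (nodes o R).map f := by
  simp [nodes, Function.comp_def]

theorem nodes_append_cons (o o' a : W) (R A : List (W × W)) :
    nodes o (R ++ (o', a) :: A) = nodes o' R ++ nodes o A := by
  simp [nodes]

theorem Admissible.map {o : W} {R : List (W × W)} (h : Admissible F o R) (f : F →g F')
    (hf : Function.Injective f) : Admissible F' (f o) (R.map (Prod.map f f)) := by
  induction h with
  | nil => exact .nil
  | cons i j R _ hi hj hij ih =>
    refine .cons (f i) (f j) _ ih ?_ ?_ (f.map_adj hij)
    · rwa [nodes_map, List.mem_map_of_injective hf]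
    · rwa [nodes_map, List.mem_map_of_injective hf]

theorem Admissible.append_cons {o o' a : W} {R A : List (W × W)} (hA : Admissible F o A)
    (hR : Admissible F o' R) (ha : a ∈ nodes o A) (hadj : F.Adj o' a)
    (hdisj : (nodes o' R).Disjoint (nodes o A)) : Admissible F o (R ++ (o', a) :: A) := by
  induction hR with
  | nil => exact .cons o' a A hA (hdisj (root_mem_nodes o' [])) ha hadj
  | cons i j R _ hi hj hij ih =>
    obtain ⟨hiA, hRA⟩ := List.disjoint_cons_left.1 hdisj
    refine .cons i j _ (ih hRA) ?_ ?_ hij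
    · simpa [nodes_append_cons] using ⟨hi, hiA⟩
    · change j ∈ nodes o (R ++ (o', a) :: A)
      rw [nodes_append_cons]
      exact List.mem_append_left _ hj

theorem Admissible.adj {o : W} {R : List (W × W)} (h : Admissible F o R) :
    ∀ e ∈ R, F.Adj e.1 e.2 := by
  induction h with
  | nil => simp
  | cons i j R _ _ _ hij ih => exact List.forall_mem_cons.2 ⟨hij, ih⟩

theorem Admissible.mem_or_mem_of_adj (hF : F.IsAcyclic) {o : W} {R : List (W × W)}
    (h : Admissible F o R) {u v : W} (hu : u ∈ nodes o R) (hv : v ∈ nodes o R)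
    (huv : F.Adj u v) : (u, v) ∈ R ∨ (v, u) ∈ R := by
  induction h with
  | nil =>
    rw [mem_nodes_nil] at hu hv
    exact absurd huv (by simp [hu, hv])
  | cons i j R hR hi hj hij ih =>
    have eq_of_adj {w : W} (hw : w ∈ nodes o R) (hiw : F.Adj i w) : w = j :=
      hR.eq_of_adj hF hi hw hj hiw hij
    rw [mem_nodes_cons] at hu hv
    rcases hu with rfl | hu <;> rcases hv with rfl | hv
    · exact absurd huv F.irrefl
    · simp [eq_of_adj hv huv]
    · simp [eq_of_adj hu huv.symm]
    · exact (ih hu hv).imp (List.mem_cons_of_mem _) (List.mem_cons_of_mem _)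

namespace AdmissibleLabeling

theorem mem_rest_or_mem_rest (L : AdmissibleLabeling F) (hF : F.IsAcyclic) {u v : W}
    (huv : F.Adj u v) : (u, v) ∈ L.rest ∨ (v, u) ∈ L.rest :=
  L.admissible.mem_or_mem_of_adj hF (L.total u) (L.total v) huv

open Classical in
/-- The numbering of the nodes of a tree given by a labeling. -/
noncomputable def equivFin (L : AdmissibleLabeling F) : Fin (L.rest.length + 1) ≃ W :=
  (finCongr (length_nodes L.root L.rest).symm).trans
    (L.admissible.nodup.getEquivOfForallMemList _ L.total)

theorem length_rest_add_one (L : AdmissibleLabeling F) : L.rest.length + 1 = Nat.card W := by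
  rw [← Nat.card_congr L.equivFin, Nat.card_fin]

theorem finite (L : AdmissibleLabeling F) : Finite W :=
  Finite.of_equiv _ L.equivFin

theorem connected (L : AdmissibleLabeling F) : F.Connected :=
  F.connected_iff_exists_forall_reachable.2 ⟨L.root, fun w =>
    (L.admissible.exists_walk w (L.total w)).choose.reachable.symm⟩

theorem isTree (L : AdmissibleLabeling F)
    (hF : ∀ u v, F.Adj u v → (u, v) ∈ L.rest ∨ (v, u) ∈ L.rest) : F.IsTree := by
  classical
  have := L.finite
  have edges_subset : F.edgeSet ⊆ L.rest.toFinset.image Sym2.mk.uncurry := by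
    intro e
    induction e with | _ u v => ?_
    intro huv
    rcases hF u v huv with h | h
    · exact Finset.mem_coe.2 (Finset.mem_image.2 ⟨(u, v), by simpa using h, rfl⟩)
    · exact Finset.mem_coe.2 (Finset.mem_image.2 ⟨(v, u), by simpa using h, Sym2.eq_swap⟩)
  have card_le : Nat.card F.edgeSet ≤ L.rest.length := by
    calc Nat.card F.edgeSet ≤ (L.rest.toFinset.image Sym2.mk.uncurry).card := by
          rw [Nat.card_coe_set_eq, ← Set.ncard_coe_finset]
          exact Set.ncard_le_ncard edges_subset (Finset.finite_toSet _)
      _ ≤ L.rest.length := Finset.card_image_le.trans L.rest.toFinset_card_le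
  refine SimpleGraph.isTree_iff_connected_and_card.2 ⟨L.connected, le_antisymm ?_ ?_⟩
  · rw [← L.length_rest_add_one]
    exact Nat.add_le_add_right card_le 1
  · exact L.connected.card_vert_le_card_edgeSet_add_one

/-- The labeling of the tree with a single node. -/
def single : AdmissibleLabeling (⊥ : SimpleGraph Unit) where
  root := ()
  rest := []
  admissible := .nil
  total _ := root_mem_nodes _ _

/-- The homomorphisms from a labeled tree are the maps that preserve the edges listed in the
labeling. -/
def homEquiv {V : Type*} (L : AdmissibleLabeling F) (hF : F.IsAcyclic) (G : SimpleGraph V) :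
    (F →g G) ≃ {f : W → V // ∀ e ∈ L.rest, G.Adj (f e.1) (f e.2)} where
  toFun f := ⟨f, fun e he => f.map_adj (L.admissible.adj e he)⟩
  invFun f := ⟨f, fun huv => (L.mem_rest_or_mem_rest hF huv).elim (f.2 _) fun h => (f.2 _ h).symm⟩

end AdmissibleLabeling

/-- The graph obtained from the disjoint union of `F` and `F'` by joining `o` to `o'`. -/
def graftGraph (F : SimpleGraph W) (F' : SimpleGraph W') (o : W) (o' : W') :
    SimpleGraph (W ⊕ W') :=
  (F ⊕g F') ⊔ SimpleGraph.edge (Sum.inl o) (Sum.inr o')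

/-- Grafting `L'` onto `L`: the root of `L'` becomes a child of the root of `L`. -/
def AdmissibleLabeling.graft (L : AdmissibleLabeling F) (L' : AdmissibleLabeling F') :
    AdmissibleLabeling (graftGraph F F' L.root L'.root) where
  root := Sum.inl L.root
  rest := L'.rest.map (Prod.map Sum.inr Sum.inr) ++
    (Sum.inr L'.root, Sum.inl L.root) :: L.rest.map (Prod.map Sum.inl Sum.inl)
  admissible := by
    have le_graft : F ⊕g F' ≤ graftGraph F F' L.root L'.root := le_sup_left
    refine .append_cons
      (L.admissible.map ((SimpleGraph.Hom.ofLE le_graft).comp SimpleGraph.Embedding.sumInl.toHom)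
        Sum.inl_injective)
      (L'.admissible.map ((SimpleGraph.Hom.ofLE le_graft).comp
        SimpleGraph.Embedding.sumInr.toHom) Sum.inr_injective) ?_ ?_ ?_
    · exact root_mem_nodes _ _
    · exact Or.inr (by simp [SimpleGraph.edge_adj])
    · simp only [nodes_map]
      simp [List.disjoint_left]
  total w := by
    rw [nodes_append_cons, nodes_map, nodes_map, List.mem_append]
    cases w with
    | inl w => exact Or.inr (List.mem_map_of_mem (L.total w))
    | inr w => exact Or.inl (List.mem_map_of_mem (L'.total w))

theorem AdmissibleLabeling.isTree_graftGraph (L : AdmissibleLabeling F)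
    (L' : AdmissibleLabeling F') (hF : F.IsAcyclic) (hF' : F'.IsAcyclic) :
    (graftGraph F F' L.root L'.root).IsTree := by
  refine (L.graft L').isTree ?_
  rintro (u | u) (v | v) huv
  · have huv : F.Adj u v := by simpa [graftGraph, SimpleGraph.edge_adj] using huv
    simpa [graft] using L.mem_rest_or_mem_rest hF huv
  · have huv : u = L.root ∧ v = L'.root := by simpa [graftGraph, SimpleGraph.edge_adj] using huv
    simp [graft, huv]
  · have huv : u = L'.root ∧ v = L.root := by simpa [graftGraph, SimpleGraph.edge_adj] using huv
    simp [graft, huv]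
  · have huv : F'.Adj u v := by simpa [graftGraph, SimpleGraph.edge_adj] using huv
    simpa [graft] using L'.mem_rest_or_mem_rest hF' huv

end Labelings

section IterIntegral

variable {W W' : Type} {X : Type*} [MeasurableSpace X] (κ : Kernel X X)

theorem iterIntegral_append (R A : List (W × W)) (h : (W → X) → ℝ≥0∞) :
    iterIntegral κ (R ++ A) h = iterIntegral κ A (iterIntegral κ R h) := by
  induction R generalizing h with
  | nil => rfl
  | cons _ _ ih => exact ih _

theorem iterIntegral_map {φ : W → W'} (hφ : Function.Injective φ) (R : List (W × W))
    (h : (W → X) → ℝ≥0∞) (x : W' → X) :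
    iterIntegral κ (R.map (Prod.map φ φ)) (fun x => h (x ∘ φ)) x = iterIntegral κ R h (x ∘ φ) := by
  induction R generalizing h with
  | nil => rfl
  | cons e R ih =>
    classical
    simp only [List.map_cons, Prod.map, iterIntegral]
    rw [← ih]
    simp only [Function.update_comp_eq_of_injective _ hφ, Function.comp_apply]

theorem iterIntegral_mul_left {o : W} {R : List (W × W)} (ho : o ∉ R.map Prod.fst)
    {f : X → ℝ≥0∞} (hf : ∀ a, f a ≠ ∞) (h : (W → X) → ℝ≥0∞) (x : W → X) :
    iterIntegral κ R (fun x => f (x o) * h x) x = f (x o) * iterIntegral κ R h x := by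
  induction R generalizing h with
  | nil => rfl
  | cons e R ih =>
    classical
    obtain ⟨hoe, hoR⟩ := not_or.1 (mt List.mem_cons.2 ho)
    simp only [iterIntegral, Function.update_of_ne hoe, lintegral_const_mul' _ _ (hf _)]
    exact ih hoR _

variable {F : SimpleGraph W} {F' : SimpleGraph W'}

theorem Admissible.dependsOn_iterIntegral {o : W} {R : List (W × W)} (hR : Admissible F o R)
    {h : (W → X) → ℝ≥0∞} (hh : DependsOn h {w | w ∈ nodes o R}) :
    DependsOn (iterIntegral κ R h) {o} := by
  induction hR generalizing h with
  | nil => exact fun x x' hxx' => hh fun w hw => hxx' w (mem_nodes_nil.1 hw)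
  | cons i j R _ _ hj _ ih =>
    refine ih fun x x' hxx' => ?_
    rw [hxx' j hj]
    refine lintegral_congr fun y => hh fun w hw => ?_
    by_cases hwi : w = i
    · simp [hwi]
    · simp [hwi, hxx' w ((mem_nodes_cons.1 hw).resolve_left hwi)]

theorem iterIntegral_rest_eq_rootedDensity (L : AdmissibleLabeling F) (x : W → X) :
    iterIntegral κ L.rest (fun _ => 1) x = rootedDensity κ L (x L.root) :=
  L.admissible.dependsOn_iterIntegral κ (fun _ _ _ => rfl) (by simp)

variable {κ}

theorem rootedDensity_le_one (hκ : ∀ x, κ x Set.univ ≤ 1) (L : AdmissibleLabeling F) (x : X) :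
    rootedDensity κ L x ≤ 1 :=
  iterIntegral_le_one hκ _ _ (fun _ => le_rfl) _

theorem rootedDensity_graft (hκ : ∀ x, κ x Set.univ ≤ 1) (L : AdmissibleLabeling F)
    (L' : AdmissibleLabeling F') (x : X) :
    rootedDensity κ (L.graft L') x = rootedDensity κ L x * ∫⁻ y, rootedDensity κ L' y ∂κ x := by
  have graft_inner (z : W ⊕ W' → X) :
      iterIntegral κ (L'.rest.map (Prod.map Sum.inr Sum.inr)) (fun _ => 1) z =
        rootedDensity κ L' (z (Sum.inr L'.root)) :=
    (iterIntegral_map κ Sum.inr_injective L'.rest (fun _ => 1) z).trans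
      (iterIntegral_rest_eq_rootedDensity κ L' _)
  have lintegral_ne_top (a : X) : ∫⁻ y, rootedDensity κ L' y ∂κ a ≠ ∞ := by
    refine ne_top_of_le_ne_top ENNReal.one_ne_top ?_
    calc ∫⁻ y, rootedDensity κ L' y ∂κ a ≤ ∫⁻ _, 1 ∂κ a :=
          lintegral_mono (rootedDensity_le_one hκ L')
      _ ≤ 1 := by simpa using hκ a
  have root_notMem : L.root ∉ L.rest.map Prod.fst := fun h =>
    List.disjoint_of_nodup_append L.admissible.nodup h (List.mem_singleton_self _)
  calc rootedDensity κ (L.graft L') x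
      = iterIntegral κ (L.rest.map (Prod.map Sum.inl Sum.inl))
          (fun z => ∫⁻ y, rootedDensity κ L' y ∂κ (z (Sum.inl L.root))) fun _ => x := by
        simp only [rootedDensity, AdmissibleLabeling.graft, iterIntegral_append, iterIntegral]
        simp only [graft_inner, Function.update_self]
        rfl
    _ = iterIntegral κ L.rest
          (fun z => (∫⁻ y, rootedDensity κ L' y ∂κ (z L.root)) * 1) fun _ => x := by
        simp only [mul_one]
        exact iterIntegral_map κ Sum.inl_injective L.rest
          (fun z => ∫⁻ y, rootedDensity κ L' y ∂κ (z L.root)) fun _ => x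
    _ = _ := by
        rw [iterIntegral_mul_left κ root_notMem lintegral_ne_top, mul_comm]
        rfl

theorem rootedDensity_single (x : X) : rootedDensity κ AdmissibleLabeling.single x = 1 := rfl

end IterIntegral

section DensityKernel

variable {W : Type} {F : SimpleGraph W} {X : Type*} {k : X → X → ℝ≥0∞}

/-- The product of the weights `k (x_{j(i)}) (x_i)` over the pairs `(i, j(i))` of the list `R`. -/
noncomputable def edgeWeight (k : X → X → ℝ≥0∞) (R : List (W × W)) (x : W → X) : ℝ≥0∞ :=
  (R.map fun e => k (x e.2) (x e.1)).prod

theorem edgeWeight_cons (i j : W) (R : List (W × W)) (x : W → X) :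
    edgeWeight k ((i, j) :: R) x = k (x j) (x i) * edgeWeight k R x := by
  simp [edgeWeight]

theorem Admissible.dependsOn_edgeWeight {o : W} {R : List (W × W)} (hR : Admissible F o R) :
    DependsOn (edgeWeight k R) {w | w ∈ nodes o R} := by
  induction hR with
  | nil => exact fun _ _ _ => rfl
  | cons i j R _ _ hj _ ih =>
    intro x x' hxx'
    have hR : ∀ w ∈ nodes o R, x w = x' w := fun w hw => hxx' w (mem_nodes_cons.2 (.inr hw))
    rw [edgeWeight_cons, edgeWeight_cons, ih hR, hR j hj, hxx' i (mem_nodes_cons.2 (.inl rfl))]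

theorem Admissible.edgeWeight_cons_update [DecidableEq W] {o i j : W} {R : List (W × W)}
    (hR : Admissible F o ((i, j) :: R)) (x : W → X) (y : X) :
    edgeWeight k ((i, j) :: R) (Function.update x i y) = edgeWeight k R x * k (x j) y := by
  obtain ⟨hR, hi, hj, -⟩ := hR.of_cons
  have update_of_mem (w : W) (hw : w ∈ nodes o R) : Function.update x i y w = x w :=
    Function.update_of_ne (ne_of_mem_of_not_mem hw hi) _ _
  rw [edgeWeight_cons, hR.dependsOn_edgeWeight update_of_mem, update_of_mem j hj,
    Function.update_self, mul_comm]

variable [MeasurableSpace X] {κ : Kernel X X} {m : Measure X}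

theorem measurable_edgeWeight (hk : Measurable (Function.uncurry k)) (R : List (W × W)) :
    Measurable (edgeWeight k R) := by
  induction R with
  | nil => exact measurable_const
  | cons e R ih =>
    exact (hk.comp ((measurable_pi_apply e.2).prodMk (measurable_pi_apply e.1))).mul ih

open Classical in
theorem Admissible.iterIntegral_withDensity [SigmaFinite m]
    (hk : Measurable (Function.uncurry k)) (hκ : ∀ x, κ x = m.withDensity (k x)) {o : W}
    {R : List (W × W)} (hR : Admissible F o R) {h : (W → X) → ℝ≥0∞} (hh : Measurable h) :
    iterIntegral κ R h =
      ∫⋯∫⁻_(R.map Prod.fst).toFinset, (fun x => edgeWeight k R x * h x) ∂fun _ => m := by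
  induction hR generalizing h with
  | nil => simp [iterIntegral, edgeWeight]
  | cons i j R hR hi hj hij ih =>
    have measurable_h : Measurable fun p : (W → X) × X => h (Function.update p.1 i p.2) :=
      hh.comp measurable_update'
    have measurable_k : Measurable fun p : (W → X) × X => k (p.1 j) p.2 :=
      hk.comp (g := Function.uncurry k) (f := fun p : (W → X) × X => (p.1 j, p.2)) (by fun_prop)
    have lintegral_node (x : W → X) : ∫⁻ y, h (Function.update x i y) ∂κ (x j) =
        ∫⁻ y, k (x j) y * h (Function.update x i y) ∂m := by
      rw [hκ]
      exact lintegral_withDensity_eq_lintegral_mul _ (measurable_k.comp measurable_prodMk_left)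
        (measurable_h.comp measurable_prodMk_left)
    have hi' : i ∉ (R.map Prod.fst).toFinset := fun h =>
      hi (List.mem_append_left _ (List.mem_toFinset.1 h))
    simp only [List.map_cons, List.toFinset_cons, iterIntegral, lintegral_node]
    have measurable_lintegral_node : Measurable fun x : W → X =>
        ∫⁻ y, k (x j) y * h (Function.update x i y) ∂m :=
      (measurable_k.mul measurable_h).lintegral_prod_right'
    have measurable_integrand : Measurable fun x => edgeWeight k ((i, j) :: R) x * h x :=
      (measurable_edgeWeight hk _).mul hh
    rw [ih measurable_lintegral_node, lmarginal_insert' _ measurable_integrand hi']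
    simp only [(Admissible.cons i j R hR hi hj hij).edgeWeight_cons_update, mul_assoc]
    congr! 2 with x
    exact (lintegral_const_mul _
      ((measurable_k.mul measurable_h).comp measurable_prodMk_left)).symm

theorem labeledDensity_withDensity [SigmaFinite m] [Fintype W]
    (hk : Measurable (Function.uncurry k)) (hκ : ∀ x, κ x = m.withDensity (k x))
    (L : AdmissibleLabeling F) :
    labeledDensity κ m L = ∫⁻ x, edgeWeight k L.rest x ∂Measure.pi fun _ => m := by
  classical
  rcases isEmpty_or_nonempty X with hX | ⟨⟨a⟩⟩
  · have : IsEmpty (W → X) := ⟨fun x => isEmptyElim (x L.root)⟩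
    simp [labeledDensity, Measure.eq_zero_of_isEmpty]
  have root_notMem : L.root ∉ (L.rest.map Prod.fst).toFinset := fun h =>
    List.disjoint_of_nodup_append L.admissible.nodup (List.mem_toFinset.1 h)
      (List.mem_singleton_self _)
  have insert_root : insert L.root (L.rest.map Prod.fst).toFinset = Finset.univ :=
    Finset.eq_univ_of_forall fun w => by simpa [nodes, or_comm] using L.total w
  calc labeledDensity κ m L
      = ∫⁻ x, iterIntegral κ L.rest (fun _ => 1) (Function.update (fun _ => a) L.root x) ∂m := by
        simp [labeledDensity, iterIntegral_rest_eq_rootedDensity]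
    _ = ∫⁻ x, (∫⋯∫⁻_(L.rest.map Prod.fst).toFinset, edgeWeight k L.rest ∂fun _ => m)
          (Function.update (fun _ => a) L.root x) ∂m := by
        rw [L.admissible.iterIntegral_withDensity hk hκ measurable_const]
        simp only [mul_one]
    _ = ∫⁻ x, edgeWeight k L.rest x ∂Measure.pi fun _ => m := by
        rw [← lmarginal_insert (μ := fun _ => m) _ (measurable_edgeWeight hk _) root_notMem,
          insert_root, lmarginal_univ]

theorem isReversible_withDensity_smul [SFinite m] (c : ℝ≥0∞)
    (hk : Measurable (Function.uncurry k)) (hκ : ∀ x, κ x = m.withDensity (k x))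
    (hsymm : ∀ x y, k x y = k y x) : κ.IsReversible (c • m) := by
  intro A B hA hB
  have lintegral_apply (C D : Set X) (hD : MeasurableSet D) :
      ∫⁻ x in C, κ x D ∂(c • m) = c * ∫⁻ x in C, ∫⁻ y in D, k x y ∂m ∂m := by
    simp only [hκ, withDensity_apply _ hD, Measure.restrict_smul, lintegral_smul_measure,
      smul_eq_mul]
  rw [lintegral_apply A B hB, lintegral_apply B A hA, lintegral_lintegral_swap hk.aemeasurable]
  simp only [hsymm]

end DensityKernel

section NeighborKernel

variable {V : Type*} (G : SimpleGraph V) (d : ℝ)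

/-- The weight `1 / d` on the edges of `G`, the density of `neighborKernel`. -/
noncomputable def neighborWeight (v : V) : V → ℝ≥0∞ :=
  (G.neighborSet v).indicator fun _ => ENNReal.ofReal d⁻¹

theorem neighborWeight_comm (v w : V) : neighborWeight G d v w = neighborWeight G d w v := by
  classical
  simp [neighborWeight, Set.indicator_apply, G.adj_comm v w]

theorem edgeWeight_neighborWeight {W : Type} (R : List (W × W)) :
    edgeWeight (neighborWeight G d) R = {f : W → V | ∀ e ∈ R, G.Adj (f e.1) (f e.2)}.indicator
      fun _ => ENNReal.ofReal d⁻¹ ^ R.length := by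
  classical
  ext f
  induction R with
  | nil => simp [edgeWeight]
  | cons e R ih =>
    rw [edgeWeight_cons, ih]
    by_cases he : G.Adj (f e.2) (f e.1) <;>
      simp [neighborWeight, Set.indicator_apply, he, G.adj_comm (f e.1), pow_succ']

variable [MeasurableSpace V] [DiscreteMeasurableSpace V]

/-- The kernel that gives mass `1 / d` to each neighbor. It is sub-Markov if all the degrees of
`G` are at most `d`. -/
noncomputable def neighborKernel : Kernel V V where
  toFun v := Measure.count.withDensity (neighborWeight G d v)
  measurable' := .of_discrete

theorem neighborKernel_apply (v : V) :
    neighborKernel G d v = Measure.count.withDensity (neighborWeight G d v) := rfl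

theorem pi_count {W : Type*} [Fintype W] [Finite V] :
    Measure.pi (fun _ : W => (Measure.count : Measure V)) = Measure.count :=
  Measure.ext_of_singleton fun f => by simp [Measure.pi_singleton]

omit [DiscreteMeasurableSpace V] in
theorem uniformOn_univ_eq_smul_count [Finite V] :
    (uniformOn Set.univ : Measure V) = (Nat.card V : ℝ≥0∞)⁻¹ • Measure.count := by
  simp [uniformOn, ProbabilityTheory.cond, Measure.count_univ, ENat.card_eq_coe_natCard]

variable {G d}

theorem IsAdmissiblePair.neighborKernel_univ_le [Finite V] (h : IsAdmissiblePair G d) (v : V) :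
    neighborKernel G d v Set.univ ≤ 1 := by
  have hd : 0 < d := one_pos.trans_le h.1
  have neighborKernel_univ :
      neighborKernel G d v Set.univ = ENNReal.ofReal (d⁻¹ * (G.neighborSet v).ncard) := by
    rw [neighborKernel_apply, withDensity_apply _ MeasurableSet.univ, setLIntegral_univ,
      neighborWeight, lintegral_indicator_const .of_discrete, Measure.count_apply .of_discrete,
      ENNReal.ofReal_mul (by positivity), ENNReal.ofReal_natCast,
      ← (Set.toFinite _).cast_ncard_eq]
    rfl
  rw [neighborKernel_univ, ENNReal.ofReal_le_one, inv_mul_le_one₀ hd]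
  exact h.2 v

theorem isReversible_neighborKernel [Finite V] :
    (neighborKernel G d).IsReversible (uniformOn Set.univ) := by
  rw [uniformOn_univ_eq_smul_count]
  exact isReversible_withDensity_smul _ .of_discrete (neighborKernel_apply G d)
    (neighborWeight_comm G d)

theorem labeledDensity_neighborKernel [Finite V] [Nonempty V] (hd : 0 < d) {W : Type}
    {F : SimpleGraph W} (hF : F.IsAcyclic) (L : AdmissibleLabeling F) :
    labeledDensity (neighborKernel G d) (uniformOn Set.univ) L =
      ENNReal.ofReal (homDensity F G d) := by
  have := L.finite
  have := Fintype.ofFinite W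
  have hom_card : Measure.count {f : W → V | ∀ e ∈ L.rest, G.Adj (f e.1) (f e.2)} =
      ENNReal.ofReal (Nat.card (F →g G)) := by
    rw [Measure.count_apply .of_discrete, ENNReal.ofReal_natCast, Nat.card_congr (L.homEquiv hF G),
      ← (Set.toFinite _).cast_ncard_eq]
    rfl
  have hL := labeledDensity_withDensity .of_discrete (neighborKernel_apply G d) L
  rw [pi_count, edgeWeight_neighborWeight, lintegral_indicator_const .of_discrete, hom_card] at hL
  calc labeledDensity (neighborKernel G d) (uniformOn Set.univ) L
      = (Nat.card V : ℝ≥0∞)⁻¹ * labeledDensity (neighborKernel G d) Measure.count L := by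
        rw [uniformOn_univ_eq_smul_count, labeledDensity, lintegral_smul_measure]
        rfl
    _ = ENNReal.ofReal (homDensity F G d) := by
        have hV : (0 : ℝ) < Nat.card V := Nat.cast_pos.2 Nat.card_pos
        rw [hL, homDensity, ← L.length_rest_add_one, Nat.add_sub_cancel, div_eq_inv_mul, mul_inv,
          mul_assoc, ← inv_pow, ENNReal.ofReal_mul (by positivity),
          ENNReal.ofReal_mul (by positivity), ENNReal.ofReal_inv_of_pos hV,
          ENNReal.ofReal_pow (by positivity), ENNReal.ofReal_natCast, ENNReal.ofReal_natCast]

end NeighborKernel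

section FactorMaps

variable {X Y : Type*} [MeasurableSpace X] [MeasurableSpace Y] {κ : Kernel X X} {η : Kernel Y Y}
  {f : X → Y}

/-- A factor map from a kernel `κ` on `X` to a kernel `η` on `Y`: pushing a step of `κ` forward
along `f` gives a step of `η`. -/
structure IsFactorMap (κ : Kernel X X) (η : Kernel Y Y) (f : X → Y) : Prop where
  measurable : Measurable f
  map_apply : ∀ x, (κ x).map f = η (f x)

theorem measurable_lintegral_update {W : Type} [IsSFiniteKernel η] {h : (W → Y) → ℝ≥0∞}
    (hh : Measurable h) (i j : W) [DecidableEq W] :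
    Measurable fun y : W → Y => ∫⁻ z, h (Function.update y i z) ∂η (y j) :=
  Measurable.lintegral_kernel_prod_right
    (κ := η.comap (fun y : W → Y => y j) (measurable_pi_apply j))
    (f := fun y z => h (Function.update y i z)) (hh.comp measurable_update')

theorem IsFactorMap.iterIntegral_comp [IsSFiniteKernel η] (hf : IsFactorMap κ η f) {W : Type}
    (R : List (W × W)) {h : (W → Y) → ℝ≥0∞} (hh : Measurable h) (x : W → X) :
    iterIntegral κ R (fun x => h (f ∘ x)) x = iterIntegral η R h (f ∘ x) := by
  induction R generalizing h with
  | nil => rfl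
  | cons e R ih =>
    classical
    rw [iterIntegral, iterIntegral, ← ih (measurable_lintegral_update hh e.1 e.2)]
    congr 1
    ext x
    simp only [Function.comp_apply, ← hf.map_apply, Function.comp_update]
    exact (lintegral_map (hh.comp (measurable_update _)) hf.measurable).symm

theorem IsFactorMap.rootedDensity_comp [IsSFiniteKernel η] (hf : IsFactorMap κ η f) {W : Type}
    {F : SimpleGraph W} (L : AdmissibleLabeling F) (x : X) :
    rootedDensity κ L x = rootedDensity η L (f x) :=
  hf.iterIntegral_comp L.rest measurable_const fun _ => x

theorem measurable_iterIntegral [IsSFiniteKernel η] {W : Type} (R : List (W × W))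
    {h : (W → Y) → ℝ≥0∞} (hh : Measurable h) : Measurable (iterIntegral η R h) := by
  induction R generalizing h with
  | nil => exact hh
  | cons e _ ih =>
    classical
    exact ih (measurable_lintegral_update hh e.1 e.2)

theorem measurable_rootedDensity [IsSFiniteKernel η] {W : Type} {F : SimpleGraph W}
    (L : AdmissibleLabeling F) : Measurable (rootedDensity η L) :=
  (measurable_iterIntegral L.rest measurable_const).comp (measurable_pi_lambda _ fun _ =>
    measurable_id)

theorem IsFactorMap.labeledDensity_map [IsSFiniteKernel η] (hf : IsFactorMap κ η f) {W : Type}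
    {F : SimpleGraph W} (π : Measure X) (L : AdmissibleLabeling F) :
    labeledDensity η (π.map f) L = labeledDensity κ π L := by
  rw [labeledDensity, lintegral_map (measurable_rootedDensity L) hf.measurable]
  exact lintegral_congr fun x => (hf.rootedDensity_comp L x).symm

theorem IsFactorMap.isReversible_map (hf : IsFactorMap κ η f) {π : Measure X}
    (hπ : κ.IsReversible π) : η.IsReversible (π.map f) := by
  have setLIntegral_map {A B : Set Y} (hA : MeasurableSet A) (hB : MeasurableSet B) :
      ∫⁻ y in A, η y B ∂π.map f = ∫⁻ x in f ⁻¹' A, κ x (f ⁻¹' B) ∂π := by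
    rw [MeasureTheory.setLIntegral_map hA (η.measurable_coe hB) hf.measurable]
    refine lintegral_congr fun x => ?_
    rw [← hf.map_apply, Measure.map_apply hf.measurable hB]
  intro A B hA hB
  rw [setLIntegral_map hA hB, setLIntegral_map hB hA]
  exact hπ (hf.measurable hA) (hf.measurable hB)

end FactorMaps

section TypeMap

theorem measurable_of_isInducing_pi {ι X Y Z : Type*} [MeasurableSpace X] [TopologicalSpace Y]
    [SecondCountableTopology Y] [MeasurableSpace Y] [BorelSpace Y] [TopologicalSpace Z]
    [MeasurableSpace Z] [OpensMeasurableSpace Z] {φ : Y → ι → Z} (hφ : IsInducing φ) {f : X → Y}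
    (hf : ∀ i, Measurable fun x => φ (f x) i) : Measurable f := by
  have subbasis : ‹TopologicalSpace Y› = TopologicalSpace.generateFrom
      (⋃ i, {s | IsOpen[.induced (fun y => φ y i) inferInstance] s}) := by
    rw [generateFrom_iUnion_isOpen fun i => TopologicalSpace.induced (fun y => φ y i) inferInstance,
      hφ.eq_induced, Pi.topologicalSpace, induced_iInf]
    simp only [induced_compose, Function.comp_def]
  rw [BorelSpace.measurable_eq (α := Y), borel_eq_generateFrom_of_subbasis subbasis]
  refine measurable_generateFrom fun s hs => ?_
  obtain ⟨i, U, hU, rfl⟩ := Set.mem_iUnion.1 hs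
  exact hf i hU.measurableSet

open scoped BoundedContinuousFunction in
theorem SubProb.measurable_of_toMeasure {X : Type*} [MeasurableSpace X] {K : Type}
    [TopologicalSpace K] [CompactSpace K] [TopologicalSpace.MetrizableSpace K]
    [MeasurableSpace K] [BorelSpace K] {f : X → SubProb K}
    (hf : Measurable fun x => (f x).toMeasure) : Measurable f := by
  have isInducing_testAgainstNN : IsInducing fun (μ : SubProb K) (g : K →ᵇ ℝ≥0) =>
      μ.1.testAgainstNN g :=
    (IsInducing.mk rfl : IsInducing fun (l : WeakDual ℝ≥0 (K →ᵇ ℝ≥0)) g => l g).comp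
      ((IsInducing.mk rfl : IsInducing (FiniteMeasure.toWeakDualBCNN (Ω := K))).comp .subtypeVal)
  refine measurable_of_isInducing_pi isInducing_testAgainstNN fun g => ?_
  exact ((Measure.measurable_lintegral
    (measurable_coe_nnreal_ennreal.comp g.continuous.measurable)).comp hf).ennreal_toNNReal

variable {X : Type*} [MeasurableSpace X] {κ : Kernel X X} (hκ : ∀ x, κ x Set.univ ≤ 1)

/-- The distribution `κ x` of a step of a sub-Markov kernel, as a finite measure. -/
noncomputable def stepMeasure (x : X) : FiniteMeasure X :=
  ⟨κ x, ⟨(hκ x).trans_lt ENNReal.one_lt_top⟩⟩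

theorem mass_stepMeasure_le (x : X) : (stepMeasure hκ x).mass ≤ 1 := by
  rw [← ENNReal.coe_le_coe, FiniteMeasure.ennreal_mass]
  exact hκ x

/-- The coordinate in `M_r` of `typeMap`: level `r + 1` at `x` is the distribution of level `r`
after one step of `κ` from `x`. -/
noncomputable def typeLevel : (r : ℕ) → X → IterSpace r
  | 0, _ => IterSpace.point
  | r + 1, x => (⟨(stepMeasure hκ x).map (typeLevel r),
      (FiniteMeasure.mass_map_le _ _).trans (mass_stepMeasure_le hκ x)⟩ : SubProb (IterSpace r))

theorem toMeasure_typeLevel_succ (r : ℕ) (x : X) :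
    SubProb.toMeasure (K := IterSpace r) (typeLevel hκ (r + 1) x) = (κ x).map (typeLevel hκ r) :=
  rfl

theorem measurable_typeLevel (r : ℕ) : Measurable (typeLevel hκ r) := by
  induction r with
  | zero => exact measurable_const
  | succ r ih =>
    exact SubProb.measurable_of_toMeasure ((Measure.measurable_map _ ih).comp κ.measurable)

theorem connect_typeLevel (r : ℕ) (x : X) :
    connect r (typeLevel hκ (r + 1) x) = typeLevel hκ r x := by
  induction r generalizing x with
  | zero => exact Subsingleton.elim _ _
  | succ r ih =>
    refine SubProb.ext (K := IterSpace r) ?_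
    change ((κ x).map (typeLevel hκ (r + 1))).map (connect r) = (κ x).map (typeLevel hκ r)
    rw [Measure.map_map (connect r).continuous.measurable (measurable_typeLevel hκ _)]
    exact congrArg (Measure.map · (κ x)) (funext ih)

/-- The map from the state space of a sub-Markov kernel to `M` that sends a point to the
distributions of the kernel seen from it to all finite depths. -/
noncomputable def typeMap (x : X) : ConsistentSpace :=
  ⟨fun r => typeLevel hκ r x, fun r => connect_typeLevel hκ r x⟩

theorem measurable_typeMap : Measurable (typeMap hκ) := by
  refine (measurable_generateFrom ?_).mono le_rfl ConsistentSpace.measurableSpace_eq.le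
  rintro _ ⟨r, A, hA, rfl⟩
  exact measurable_typeLevel hκ r hA

namespace ConsistentSpace

theorem measure_ext {μ ν : Measure ConsistentSpace} [IsFiniteMeasure μ]
    (h : ∀ r, μ.map (proj r) = ν.map (proj r)) : μ = ν := by
  have cylinder (r : ℕ) {A : Set (IterSpace r)} (hA : MeasurableSet A) :
      μ (proj r ⁻¹' A) = ν (proj r ⁻¹' A) := by
    rw [← Measure.map_apply (proj r).continuous.measurable hA, h,
      Measure.map_apply (proj r).continuous.measurable hA]
  refine ext_of_generate_finite _ measurableSpace_eq isPiSystem_cylinder ?_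
    (cylinder 0 MeasurableSet.univ)
  rintro _ ⟨r, A, hA, rfl⟩
  exact cylinder r hA

theorem deg_map_proj (σ : ConsistentSpace) (r : ℕ) :
    (deg σ).map (proj r) = (marginal σ r).toMeasure :=
  Measure.ext fun A hA => by
    rw [Measure.map_apply (proj r).continuous.measurable hA]
    exact deg_cylinder σ r hA

instance : IsFiniteKernel deg := ⟨1, ENNReal.one_lt_top, deg_univ_le⟩

end ConsistentSpace

open ConsistentSpace in
theorem isFactorMap_typeMap : IsFactorMap κ deg (typeMap hκ) where
  measurable := measurable_typeMap hκ
  map_apply x := by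
    refine (measure_ext fun r => ?_).symm
    rw [deg_map_proj, Measure.map_map (proj r).continuous.measurable (measurable_typeMap hκ)]
    exact toMeasure_typeLevel_succ hκ r x

end TypeMap

section Feller

variable {X : Type*} [TopologicalSpace X] [CompactSpace X] [MeasurableSpace X]

theorem integrable_continuousMap [OpensMeasurableSpace X] (ν : Measure X) [IsFiniteMeasure ν]
    (g : C(X, ℝ)) : Integrable g ν :=
  (BoundedContinuousFunction.mkOfCompact g).integrable ν

theorem norm_integral_continuousMap_le (ν : Measure X) [IsFiniteMeasure ν] (g : C(X, ℝ)) :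
    ‖∫ x, g x ∂ν‖ ≤ ν.real Set.univ * ‖g‖ := by
  rw [mul_comm]
  exact norm_integral_le_of_norm_le_const (ae_of_all _ g.norm_coe_le_norm)

/-- Integration against a finite measure, as a functional on the continuous functions. -/
noncomputable def integralCLM [OpensMeasurableSpace X] (ν : Measure X) [IsFiniteMeasure ν] :
    C(X, ℝ) →L[ℝ] ℝ :=
  LinearMap.mkContinuous
    { toFun g := ∫ x, g x ∂ν
      map_add' f g := integral_add (integrable_continuousMap ν f) (integrable_continuousMap ν g)
      map_smul' c g := integral_const_mul c g } _ (norm_integral_continuousMap_le ν)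

theorem ext_of_integralCLM_eq [BorelSpace X] [HasOuterApproxClosed X] {μ ν : Measure X}
    [IsFiniteMeasure μ] [IsFiniteMeasure ν] (h : integralCLM μ = integralCLM ν) : μ = ν :=
  ext_of_forall_integral_eq_of_IsFiniteMeasure fun g => DFunLike.congr_fun h g.toContinuousMap

/-- A sub-Markov kernel on a compact space that maps continuous functions to continuous
functions. -/
structure IsFeller (κ : Kernel X X) : Prop where
  apply_univ_le : ∀ x, κ x Set.univ ≤ 1
  continuous_integral : ∀ g : C(X, ℝ), Continuous fun x => ∫ y, g y ∂κ x

namespace IsFeller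

variable {κ : Kernel X X} (hκ : IsFeller κ)
include hκ

omit [CompactSpace X] in
theorem isFiniteKernel : IsFiniteKernel κ := ⟨1, ENNReal.one_lt_top, hκ.apply_univ_le⟩

omit [CompactSpace X] in
theorem real_apply_univ_le (x : X) : (κ x).real Set.univ ≤ 1 :=
  ENNReal.toReal_le_of_le_ofReal zero_le_one (by simpa using hκ.apply_univ_le x)

variable [OpensMeasurableSpace X]

/-- The operator `g ↦ (x ↦ ∫ g dκ(x))` on the continuous functions. -/
noncomputable def operator : C(X, ℝ) →L[ℝ] C(X, ℝ) :=
  have := hκ.isFiniteKernel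
  LinearMap.mkContinuous
    { toFun g := ⟨fun x => ∫ y, g y ∂κ x, hκ.continuous_integral g⟩
      map_add' f g := ContinuousMap.ext fun x => map_add (integralCLM (κ x)) f g
      map_smul' c g := ContinuousMap.ext fun x => map_smul (integralCLM (κ x)) c g } 1
    fun g => (ContinuousMap.norm_le _ (by positivity)).2 fun x =>
      (norm_integral_continuousMap_le (κ x) g).trans
        (mul_le_mul_of_nonneg_right (hκ.real_apply_univ_le x) (norm_nonneg g))

theorem operator_apply (g : C(X, ℝ)) (x : X) : hκ.operator g x = ∫ y, g y ∂κ x := rfl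

theorem continuous_integral_prod {Y : Type*} [TopologicalSpace Y] (h : C(Y × X, ℝ)) {f : Y → X}
    (hf : Continuous f) : Continuous fun y => ∫ z, h (y, z) ∂κ (f y) :=
  (hκ.operator.continuous.comp h.curry.continuous).eval hf

theorem continuous_lintegral_prod {Y : Type*} [TopologicalSpace Y] {h : Y × X → ℝ≥0∞}
    (hh : Continuous h) (h_le : ∀ p, h p ≤ 1) {f : Y → X} (hf : Continuous f) :
    Continuous fun y => ∫⁻ z, h (y, z) ∂κ (f y) := by
  have h_ne_top (p : Y × X) : h p ≠ ∞ := ne_top_of_le_ne_top ENNReal.one_ne_top (h_le p)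
  have continuous_toReal : Continuous fun p => (h p).toReal :=
    ENNReal.continuousOn_toReal.comp_continuous hh h_ne_top
  refine (ENNReal.continuous_ofReal.comp
    (hκ.continuous_integral_prod ⟨_, continuous_toReal⟩ hf)).congr fun y => ?_
  have := hκ.isFiniteKernel
  have integrable_slice : Integrable (fun z => (h (y, z)).toReal) (κ (f y)) :=
    integrable_continuousMap _ ⟨_, continuous_toReal.comp (Continuous.prodMk_right y)⟩
  refine (ofReal_integral_eq_lintegral_ofReal integrable_slice
    (ae_of_all _ fun z => ENNReal.toReal_nonneg)).trans ?_
  simp only [ENNReal.ofReal_toReal (h_ne_top _)]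

theorem continuous_iterIntegral {W : Type} (R : List (W × W)) {h : (W → X) → ℝ≥0∞}
    (hh : Continuous h) (h_le : ∀ x, h x ≤ 1) : Continuous (iterIntegral κ R h) := by
  induction R generalizing h with
  | nil => exact hh
  | cons e _ ih =>
    classical
    refine ih (hκ.continuous_lintegral_prod (f := fun x : W → X => x e.2)
      (hh.comp (continuous_fst.update e.1 continuous_snd)) (fun p => h_le _)
      (continuous_apply e.2)) fun x => ?_
    exact iterIntegral_le_one hκ.apply_univ_le [e] h h_le x

variable {W : Type} {F : SimpleGraph W}

/-- The rooted density of a labeled tree, as a continuous function of the root. -/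
noncomputable def densityMap (L : AdmissibleLabeling F) : C(X, ℝ) where
  toFun x := (rootedDensity κ L x).toReal
  continuous_toFun := ENNReal.continuousOn_toReal.comp_continuous
    ((hκ.continuous_iterIntegral L.rest continuous_const fun _ => le_rfl).comp
      (continuous_pi fun _ => continuous_id))
    fun x => ne_top_of_le_ne_top ENNReal.one_ne_top (rootedDensity_le_one hκ.apply_univ_le L x)

theorem integral_densityMap (L : AdmissibleLabeling F) (π : Measure X) :
    ∫ x, hκ.densityMap L x ∂π = (labeledDensity κ π L).toReal := by
  have := hκ.isFiniteKernel
  exact integral_toReal (measurable_rootedDensity L).aemeasurable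
    (ae_of_all _ fun x => (rootedDensity_le_one hκ.apply_univ_le L x).trans_lt ENNReal.one_lt_top)

theorem densityMap_single : hκ.densityMap AdmissibleLabeling.single = 1 := by
  ext
  simp [densityMap, rootedDensity_single]

theorem densityMap_graft {W' : Type} {F' : SimpleGraph W'} (L : AdmissibleLabeling F)
    (L' : AdmissibleLabeling F') :
    hκ.densityMap (L.graft L') = hκ.densityMap L * hκ.operator (hκ.densityMap L') := by
  ext x
  rw [ContinuousMap.mul_apply, operator_apply, integral_densityMap]
  simp only [densityMap, ContinuousMap.coe_mk, rootedDensity_graft hκ.apply_univ_le,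
    ENNReal.toReal_mul]
  rfl

theorem continuous_treeDensity [Finite W] (hF : F.IsTree) :
    Continuous fun π : ProbabilityMeasure X => (treeDensity κ (π : Measure X) hF).toReal := by
  simp only [treeDensity, ← hκ.integral_densityMap]
  exact ProbabilityMeasure.continuous_integral_continuousMap _

end IsFeller

theorem isReversible_iff_map_swap_compProd {X : Type*} [MeasurableSpace X] {κ : Kernel X X}
    [IsFiniteKernel κ] {π : Measure X} [IsFiniteMeasure π] :
    κ.IsReversible π ↔ (π ⊗ₘ κ).map Prod.swap = π ⊗ₘ κ := by
  rw [Measure.ext_prod_iff]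
  refine forall₂_congr fun A B => forall₂_congr fun hA hB => ?_
  rw [Measure.map_apply measurable_swap (hA.prod hB), Set.preimage_swap_prod,
    Measure.compProd_apply_prod hA hB, Measure.compProd_apply_prod hB hA, eq_comm]

theorem IsFeller.isReversible_iff [BorelSpace X] [TopologicalSpace.MetrizableSpace X]
    {κ : Kernel X X} (hκ : IsFeller κ) {π : Measure X} [IsFiniteMeasure π] :
    κ.IsReversible π ↔ ∀ h : C(X × X, ℝ),
      ∫ x, ∫ y, h (y, x) ∂κ x ∂π = ∫ x, ∫ y, h (x, y) ∂κ x ∂π := by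
  have := hκ.isFiniteKernel
  have integralCLM_compProd (h : C(X × X, ℝ)) :
      integralCLM (π ⊗ₘ κ) h = ∫ x, ∫ y, h (x, y) ∂κ x ∂π :=
    Measure.integral_compProd (integrable_continuousMap _ h)
  have integralCLM_map_swap (h : C(X × X, ℝ)) :
      integralCLM ((π ⊗ₘ κ).map Prod.swap) h = ∫ x, ∫ y, h (y, x) ∂κ x ∂π :=
    (integral_map measurable_swap.aemeasurable h.continuous.aestronglyMeasurable).trans
      (integralCLM_compProd (h.comp .prodSwap))
  rw [isReversible_iff_map_swap_compProd]
  simp only [← integralCLM_compProd, ← integralCLM_map_swap]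
  exact ⟨fun h g => by simp only [h], fun h => ext_of_integralCLM_eq (ContinuousLinearMap.ext h)⟩

theorem IsFeller.isClosed_setOf_isReversible [BorelSpace X] [TopologicalSpace.MetrizableSpace X]
    {κ : Kernel X X} (hκ : IsFeller κ) :
    IsClosed {π : ProbabilityMeasure X | κ.IsReversible (π : Measure X)} := by
  have continuous_integral (h : C(X × X, ℝ)) :
      Continuous fun π : ProbabilityMeasure X => ∫ x, ∫ y, h (x, y) ∂κ x ∂(π : Measure X) :=
    ProbabilityMeasure.continuous_integral_continuousMap
      (⟨_, hκ.continuous_integral_prod h continuous_id⟩ : C(X, ℝ))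
  simp only [hκ.isReversible_iff, Set.ofPred_forall]
  exact isClosed_iInter fun h =>
    isClosed_eq (continuous_integral (h.comp .prodSwap)) (continuous_integral h)

end Feller

namespace ConsistentSpace

theorem ofMeasure_degMeasure (σ : ConsistentSpace) : ofMeasure (degMeasure σ) = σ := by
  refine Subtype.ext (funext fun r => ?_)
  cases r with
  | zero => exact Subsingleton.elim _ _
  | succ r => exact SubProb.ext (K := IterSpace r) (deg_map_proj σ r)

theorem degMeasure_ofMeasure (μ : SubProb ConsistentSpace) : degMeasure (ofMeasure μ) = μ :=
  SubProb.ext <| measure_ext fun r => deg_map_proj (ofMeasure μ) r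

theorem continuous_degMeasure : Continuous degMeasure :=
  Continuous.continuous_symm_of_equiv_compact_to_t2
    (f := ⟨ofMeasure, degMeasure, degMeasure_ofMeasure, ofMeasure_degMeasure⟩) ofMeasure.continuous

theorem isFeller_deg : IsFeller deg where
  apply_univ_le := deg_univ_le
  continuous_integral g := (FiniteMeasure.continuous_integral_continuousMap g).comp
    (continuous_subtype_val.comp continuous_degMeasure)

end ConsistentSpace

section Separation

/-- The integral of a fixed continuous function, as a continuous function of the measure. -/
noncomputable def SubProb.integral {K : Type} [TopologicalSpace K] [CompactSpace K]
    [MeasurableSpace K] [BorelSpace K] (φ : C(K, ℝ)) : C(SubProb K, ℝ) where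
  toFun μ := ∫ x, φ x ∂μ.toMeasure
  continuous_toFun :=
    (FiniteMeasure.continuous_integral_continuousMap φ).comp continuous_subtype_val

theorem SubProb.ext_of_integral_eq {K : Type} [TopologicalSpace K] [CompactSpace K]
    [MeasurableSpace K] [BorelSpace K] [HasOuterApproxClosed K] {μ ν : SubProb K}
    (h : ∀ φ, integral φ μ = integral φ ν) : μ = ν :=
  SubProb.ext (ext_of_integralCLM_eq (ContinuousLinearMap.ext h))

theorem eq_top_of_isClosed_of_separatesPoints {X : Type*} [TopologicalSpace X] [CompactSpace X]
    {A : Subalgebra ℝ C(X, ℝ)} (isClosed : IsClosed (A : Set C(X, ℝ)))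
    (separatesPoints : A.SeparatesPoints) : A = ⊤ :=
  (A.topologicalClosure_minimal le_rfl isClosed).antisymm' A.le_topologicalClosure |>.trans <|
    ContinuousMap.subalgebra_topologicalClosure_eq_top_of_separatesPoints A separatesPoints

theorem measure_ext_of_submonoid {X : Type*} [TopologicalSpace X] [CompactSpace X]
    [HasOuterApproxClosed X] [MeasurableSpace X] [BorelSpace X] {S : Submonoid C(X, ℝ)}
    (hS : (Algebra.adjoin ℝ (S : Set C(X, ℝ))).topologicalClosure = ⊤) {μ ν : Measure X}
    [IsFiniteMeasure μ] [IsFiniteMeasure ν] (h : ∀ g ∈ S, ∫ x, g x ∂μ = ∫ x, g x ∂ν) : μ = ν := by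
  refine ext_of_integralCLM_eq (ContinuousLinearMap.ext_on (s := (S : Set C(X, ℝ))) ?_ h)
  have span_eq_adjoin : (Submodule.span ℝ (S : Set C(X, ℝ)) : Set C(X, ℝ)) =
      Algebra.adjoin ℝ (S : Set C(X, ℝ)) := by
    rw [← Subalgebra.coe_toSubmodule, Algebra.adjoin_eq_span, Submonoid.closure_eq]
  rw [span_eq_adjoin, dense_iff_closure_eq, ← Subalgebra.topologicalClosure_coe, hS]
  rfl

/-- The elements that multiply a given set `T` into itself from the right. They are closed under
products even if `T` is not. -/
def multiplierSubmonoid {α : Type*} [Monoid α] (T : Set α) : Submonoid α where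
  carrier := {t | ∀ f ∈ T, f * t ∈ T}
  one_mem' f hf := by rwa [mul_one]
  mul_mem' hs ht f hf := by
    rw [← mul_assoc]
    exact ht _ (hs f hf)

theorem multiplierSubmonoid_subset {α : Type*} [Monoid α] {T : Set α} (one_mem : 1 ∈ T) :
    (multiplierSubmonoid T : Set α) ⊆ T := fun t ht => by
  simpa only [one_mul] using ht 1 one_mem

namespace ConsistentSpace

/-- The operator `g ↦ (σ ↦ ∫ g d deg(σ))` on the continuous functions on `M`. -/
noncomputable abbrev degOperator : C(ConsistentSpace, ℝ) →L[ℝ] C(ConsistentSpace, ℝ) :=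
  isFeller_deg.operator

theorem degOperator_comp_proj (r : ℕ) (φ : C(IterSpace r, ℝ)) :
    degOperator (φ.comp (proj r)) =
      ContinuousMap.comp (SubProb.integral φ) (proj (r + 1)) := by
  ext σ
  change ∫ τ, φ (proj r τ) ∂deg σ = ∫ x, φ x ∂(marginal σ r).toMeasure
  rw [← deg_map_proj, integral_map (by fun_prop) (by fun_prop)]

theorem comap_compRightAlgHom_proj_eq_top {B : Subalgebra ℝ C(ConsistentSpace, ℝ)}
    (isClosed : IsClosed (B : Set C(ConsistentSpace, ℝ)))
    (degOperator_mem : ∀ g ∈ B, degOperator g ∈ B) (r : ℕ) :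
    B.comap (ContinuousMap.compRightAlgHom ℝ ℝ (proj r)) = ⊤ := by
  have comap_isClosed (r : ℕ) :=
    isClosed.preimage (ContinuousMap.compRightAlgHom_continuous (R := ℝ) (A := ℝ) (proj r))
  induction r with
  | zero =>
    exact eq_top_of_isClosed_of_separatesPoints (comap_isClosed 0) fun x y hxy =>
      (hxy (Subsingleton.elim x y)).elim
  | succ r ih =>
    refine eq_top_of_isClosed_of_separatesPoints (comap_isClosed (r + 1))
      fun (μ : SubProb (IterSpace r)) ν hμν => ?_
    obtain ⟨φ, hφ⟩ := not_forall.1 (mt SubProb.ext_of_integral_eq hμν)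
    have comp_mem : φ.comp (proj r) ∈ B := (Subalgebra.mem_comap _ _ φ).1 (ih.ge Algebra.mem_top)
    have integral_comp_mem : ContinuousMap.comp (SubProb.integral φ) (proj (r + 1)) ∈ B := by
      rw [← degOperator_comp_proj]
      exact degOperator_mem _ comp_mem
    exact ⟨_, ⟨SubProb.integral φ, integral_comp_mem, rfl⟩, hφ⟩

theorem topologicalClosure_eq_top_of_degOperator_mem {A : Subalgebra ℝ C(ConsistentSpace, ℝ)}
    (degOperator_mem : ∀ g ∈ A, degOperator g ∈ A) : A.topologicalClosure = ⊤ := by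
  refine eq_top_of_isClosed_of_separatesPoints A.isClosed_topologicalClosure fun σ τ hστ => ?_
  obtain ⟨r, hr⟩ := Function.ne_iff.1 (Subtype.coe_injective.ne hστ)
  obtain ⟨φ, φ_continuous, hφ⟩ := separatesPoints_continuous_of_t35Space hr
  have comap_eq_top := comap_compRightAlgHom_proj_eq_top A.isClosed_topologicalClosure
    (fun g hg => map_mem_closure degOperator.continuous hg degOperator_mem) r
  exact ⟨_, ⟨ContinuousMap.comp ⟨φ, φ_continuous⟩ (proj r),
    (Subalgebra.mem_comap _ _ _).1 (comap_eq_top.ge Algebra.mem_top), rfl⟩, hφ⟩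

theorem measure_ext_of_mul_degOperator_mem {T : Set C(ConsistentSpace, ℝ)} (one_mem : 1 ∈ T)
    (mul_degOperator_mem : ∀ f ∈ T, ∀ g ∈ T, f * degOperator g ∈ T)
    {μ ν : Measure ConsistentSpace} [IsFiniteMeasure μ] [IsFiniteMeasure ν]
    (h : ∀ g ∈ T, ∫ σ, g σ ∂μ = ∫ σ, g σ ∂ν) : μ = ν := by
  have subset := multiplierSubmonoid_subset one_mem
  refine measure_ext_of_submonoid (S := multiplierSubmonoid T) ?_ fun g hg => h g (subset hg)
  refine topologicalClosure_eq_top_of_degOperator_mem fun g hg => ?_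
  rw [← Subalgebra.mem_toSubmodule, Algebra.adjoin_eq_span, Submonoid.closure_eq] at hg ⊢
  refine (Submodule.map_span_le degOperator.toLinearMap _ _).2 (fun t ht => ?_) ⟨g, hg, rfl⟩
  exact Submodule.subset_span fun f hf => mul_degOperator_mem f hf t (subset ht)

theorem eq_of_treeDensity_eq {μ ν : Measure ConsistentSpace} [IsFiniteMeasure μ]
    [IsFiniteMeasure ν] (hμ : deg.IsReversible μ) (hν : deg.IsReversible ν)
    (h : ∀ (W : Type) [Finite W] (F : SimpleGraph W) (hF : F.IsTree),
      (treeDensity deg μ hF).toReal = (treeDensity deg ν hF).toReal) : μ = ν := by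
  refine measure_ext_of_mul_degOperator_mem (T := {t | ∃ (W : Type) (F : SimpleGraph W)
    (L : AdmissibleLabeling F), F.IsTree ∧ t = isFeller_deg.densityMap L}) ?_ ?_ ?_
  · exact ⟨Unit, ⊥, .single, .of_subsingleton, isFeller_deg.densityMap_single.symm⟩
  · rintro _ ⟨W, F, L, hF, rfl⟩ _ ⟨W', F', L', hF', rfl⟩
    exact ⟨_, _, L.graft L', L.isTree_graftGraph L' hF.isAcyclic hF'.isAcyclic,
      (isFeller_deg.densityMap_graft L L').symm⟩
  · rintro _ ⟨W, F, L, hF, rfl⟩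
    have := L.finite
    rw [isFeller_deg.integral_densityMap, isFeller_deg.integral_densityMap,
      ← treeDensity_eq hμ hF L, ← treeDensity_eq hν hF L]
    exact h W F hF

end ConsistentSpace

end Separation

theorem IsAdmissiblePair.exists_probabilityMeasure {V : Type*} [Finite V] [Nonempty V]
    {G : SimpleGraph V} {d : ℝ} (h : IsAdmissiblePair G d) :
    ∃ ν : ProbabilityMeasure ConsistentSpace,
      ConsistentSpace.deg.IsReversible (ν : Measure ConsistentSpace) ∧
      ∀ (W : Type) [Finite W] (F : SimpleGraph W) (hF : F.IsTree),
        (treeDensity ConsistentSpace.deg (ν : Measure ConsistentSpace) hF).toReal =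
          homDensity F G d := by
  have hd : 0 < d := one_pos.trans_le h.1
  let : MeasurableSpace V := ⊤
  have : IsProbabilityMeasure (uniformOn (Set.univ : Set V)) :=
    isProbabilityMeasure_uniformOn Set.finite_univ Set.univ_nonempty
  have isFactorMap := isFactorMap_typeMap h.neighborKernel_univ_le
  have reversible := isFactorMap.isReversible_map isReversible_neighborKernel
  refine ⟨⟨_, Measure.isProbabilityMeasure_map isFactorMap.measurable.aemeasurable⟩,
    reversible, fun W _ F hF => ?_⟩
  obtain ⟨L⟩ := nonempty_admissibleLabeling hF
  have homDensity_nonneg : 0 ≤ homDensity F G d := by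
    unfold homDensity
    positivity
  rw [ProbabilityMeasure.coe_mk, treeDensity_eq reversible hF L, isFactorMap.labeledDensity_map,
    labeledDensity_neighborKernel hd hF.isAcyclic, ENNReal.toReal_ofReal homDensity_nonneg]

end GraphLimit

theorem mainTheorem7 (V : ℕ → Type*) [∀ n, Finite (V n)] [∀ n, Nonempty (V n)]
    (G : (n : ℕ) → SimpleGraph (V n)) (d : ℕ → ℝ)
    (hadm : ∀ n, GraphLimit.IsAdmissiblePair (G n) (d n))
    (hconv : ∀ (W : Type) [Finite W] (F : SimpleGraph W), F.IsTree →
      ∃ a : ℝ, Tendsto (fun n => GraphLimit.homDensity F (G n) (d n)) atTop (𝓝 a)) :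
    ∃! ν : ProbabilityMeasure GraphLimit.ConsistentSpace,
      GraphLimit.ConsistentSpace.deg.IsReversible (ν : Measure GraphLimit.ConsistentSpace) ∧
      ∀ (W : Type) [Finite W] (F : SimpleGraph W) (hF : F.IsTree),
        Tendsto (fun n => GraphLimit.homDensity F (G n) (d n)) atTop
          (𝓝 (GraphLimit.treeDensity GraphLimit.ConsistentSpace.deg
            (ν : Measure GraphLimit.ConsistentSpace) hF).toReal) := by
  have isFeller := GraphLimit.ConsistentSpace.isFeller_deg
  choose ν reversible density_eq using fun n => (hadm n).exists_probabilityMeasure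
  obtain ⟨μ, cluster⟩ := exists_clusterPt_of_compactSpace (map ν atTop)
  have μ_reversible := isFeller.isClosed_setOf_isReversible.closure_subset
    (mem_closure_iff_clusterPt.2 (cluster.mono (tendsto_principal.2 (.of_forall reversible))))
  have tendsto_density (W : Type) [Finite W] (F : SimpleGraph W) (hF : F.IsTree) :
      Tendsto (fun n => GraphLimit.homDensity F (G n) (d n)) atTop
        (𝓝 (GraphLimit.treeDensity GraphLimit.ConsistentSpace.deg
          (μ : Measure GraphLimit.ConsistentSpace) hF).toReal) := by
    obtain ⟨a, ha⟩ := hconv W F hF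
    have density_cluster := cluster.map (isFeller.continuous_treeDensity hF).continuousAt
      (tendsto_map' (ha.congr fun n => (density_eq n W F hF).symm))
    rwa [eq_of_nhds_neBot density_cluster]
  refine ⟨μ, ⟨μ_reversible, tendsto_density⟩, fun ρ ⟨ρ_reversible, hρ⟩ => ?_⟩
  refine ProbabilityMeasure.toMeasure_injective ?_
  exact GraphLimit.ConsistentSpace.eq_of_treeDensity_eq ρ_reversible μ_reversible
    fun W _ F hF => tendsto_nhds_unique (hρ W F hF) (tendsto_density W F hF)
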